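/- Let $f:[0,1]^2\to\mathbb R$ be a function whose pure second partial derivatives $f''_{xx}=(f'_x)'_x$ and $f''_{yy}=(f'_y)'_y$ exist (as finite derivatives) at every point of $[0,1]^2$ and are square integrable on $[0,1]^2$ with respect to Lebesgue measure. (Here and below, derivatives in a variable at the endpoints $0$ and $1$ of its interval are one-sided.) Then: (i) at almost every point of $[0,1]^2$ both mixed derivatives $f''_{xy}=(f'_x)'_y$ and $f''_{yx}=(f'_y)'_x$ exist and are equal, and these almost everywhere defined functions are square integrable on $[0,1]^2$; (ii) there is a measurable set $A\subseteq[0,1]$ of Lebesgue measure $1$ such that for every $x\in A$ the function $y\mapsto f'_x(x,y)$ is continuous at every point $y\in[0,1]$; (iii) $f$ is jointly continuous on $[0,1]^2$. -/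

import Mathlib

open Set MeasureTheory

/-- The closed unit square `[0,1]²`. -/
def unitSquare : Set (ℝ × ℝ) := Icc (0 : ℝ) 1 ×ˢ Icc (0 : ℝ) 1

/-- `g` is differentiable in the first variable at `p`, as a function on `[0,1]²`
(one-sidedly where `p.1` is an endpoint of `[0,1]`). At points of the square this involves only the
values of `g` on the square. -/
def DiffX (g : ℝ × ℝ → ℝ) (p : ℝ × ℝ) : Prop :=
  DifferentiableWithinAt ℝ (fun t => g (t, p.2)) (Icc 0 1) p.1

/-- `g` is differentiable in the second variable at `p`, as a function on `[0,1]²`. -/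
def DiffY (g : ℝ × ℝ → ℝ) (p : ℝ × ℝ) : Prop :=
  DifferentiableWithinAt ℝ (fun t => g (p.1, t)) (Icc 0 1) p.2

/-- The partial derivative of `g` in the first variable on `[0,1]²`
(meaningful at the points where `DiffX g p` holds, and `0` where it fails). -/
noncomputable def partialX (g : ℝ × ℝ → ℝ) (p : ℝ × ℝ) : ℝ :=
  derivWithin (fun t => g (t, p.2)) (Icc 0 1) p.1

/-- The partial derivative of `g` in the second variable on `[0,1]²`
(meaningful at the points where `DiffY g p` holds, and `0` where it fails). -/
noncomputable def partialY (g : ℝ × ℝ → ℝ) (p : ℝ × ℝ) : ℝ :=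
  derivWithin (fun t => g (p.1, t)) (Icc 0 1) p.2

/-- `g` is square integrable on `[0,1]²` with respect to the Lebesgue measure. -/
def SquareIntegrable (g : ℝ × ℝ → ℝ) : Prop :=
  MemLp g 2 (volume.restrict unitSquare)

/-! The heart of the matter is the identity ∫ |w_xy|² = ∫ w_xx w_yy for functions on the plane,
which bounds the mixed derivative in L² by the pure ones. Since `f''_xy` is not known to exist, the
identity is used for finite differences (`integral_mixed_difference_sq`), where it is summation by
parts and needs only w ∈ L².

To avoid boundary terms, `f` is first extended to the plane by a reflection with cutoff in each
variable (`hestenes2`) that preserves C¹ regularity of sections. An everywhere finite, integrable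
derivative satisfies the fundamental theorem of calculus, so the second difference of the extension
with step h has L² norm O(h²) (`exists_lintegral_second_difference_le`, applied in both variables).
Hence the mixed difference quotients are bounded in L² (`lintegral_mixed_difference_le`), and a weak
limit point g satisfies ∫∫_{[0,a]×[0,b]} g = f(a,b) - f(a,0) - f(0,b) + f(0,0)
(`exists_weak_mixed_derivative`).

Everything follows from this representation. The right-hand side determines f from g and two
continuous boundary sections, so f is jointly continuous. Differentiating in x gives f'_x(x,y) =
f'_x(x,0) + ∫_0^y g(x,t) dt for almost every x and all y at once (`ae_partial_eq`); this yields
continuity in y, and by Lebesgue differentiation f''_xy = g almost everywhere. The representation is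
symmetric in the variables, so f''_yx = g as well. -/

open Filter Topology
open scoped ENNReal NNReal

/-! ### Second differences and L² estimates on the line. -/

/-- Cauchy–Schwarz for the integral of a nonnegative function on a space of finite measure. -/
theorem lintegral_pow_two_le {α : Type*} [MeasurableSpace α] (μ : Measure α) {φ : α → ℝ≥0∞}
    (hφ : AEMeasurable φ μ) : (∫⁻ x, φ x ∂μ) ^ 2 ≤ μ univ * ∫⁻ x, φ x ^ 2 ∂μ := by
  have h := ENNReal.lintegral_mul_le_Lp_mul_Lq μ Real.HolderConjugate.two_two hφ
    (aemeasurable_const (b := (1 : ℝ≥0∞)))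
  simp only [Pi.mul_apply, mul_one, ENNReal.one_rpow, lintegral_const, one_mul] at h
  have h2 := pow_le_pow_left' h 2
  rw [mul_pow, ← ENNReal.rpow_natCast, ← ENNReal.rpow_natCast (_ ^ (1 / 2 : ℝ)),
    ← ENNReal.rpow_natCast (_ ^ (1 / 2 : ℝ)), ← ENNReal.rpow_mul, ← ENNReal.rpow_mul] at h2
  norm_num at h2
  rw [mul_comm]
  exact_mod_cast h2

theorem setLIntegral_Icc_sub_add (φ : ℝ → ℝ≥0∞) (x h : ℝ) :
    ∫⁻ t in Icc (x - h) (x + h), φ t = ∫⁻ r in Icc (-h) h, φ (x + r) := by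
  rw [← lintegral_indicator measurableSet_Icc, ← lintegral_indicator measurableSet_Icc,
    ← lintegral_add_left_eq_self _ x]
  congr 1
  ext r
  simp only [indicator, mem_Icc]
  congr 1
  apply propext
  constructor <;> rintro ⟨h1, h2⟩ <;> constructor <;> linarith

theorem lintegral_window {φ : ℝ → ℝ≥0∞} (hφ : Measurable φ) (h : ℝ) :
    ∫⁻ x, ∫⁻ t in Icc (x - h) (x + h), φ t = ENNReal.ofReal (2 * h) * ∫⁻ t, φ t := by
  simp_rw [setLIntegral_Icc_sub_add]
  rw [lintegral_lintegral_swap (by fun_prop)]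
  simp_rw [lintegral_add_right_eq_self (fun x => φ x)]
  rw [lintegral_const, Measure.restrict_apply_univ, Real.volume_Icc, mul_comm]
  congr 2
  ring

/-- The difference of values of an antiderivative is controlled by the integral of the derivative. -/
theorem enorm_sub_le_lintegral_of_hasDerivAt_off_countable {u u' : ℝ → ℝ} {s : Set ℝ}
    (hs : s.Countable) {a b : ℝ} (hab : a ≤ b) (hu : ContinuousOn u (Icc a b))
    (hd : ∀ x ∈ Ioo a b \ s, HasDerivAt u (u' x) x)
    (hi : IntegrableOn u' (Ioc a b)) :
    ‖u b - u a‖ₑ ≤ ∫⁻ t in Icc a b, ‖u' t‖ₑ := by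
  rw [← integral_eq_of_hasDerivAt_off_countable_of_le u u' hab hs hu hd
    ((intervalIntegrable_iff_integrableOn_Ioc_of_le hab).2 hi),
    intervalIntegral.integral_of_le hab]
  exact (enorm_integral_le_lintegral_enorm _).trans (lintegral_mono_set Ioc_subset_Icc_self)

theorem integrableOn_of_lintegral_sq_lt_top {u : ℝ → ℝ} (hu : AEStronglyMeasurable u)
    (h : ∫⁻ x, ‖u x‖ₑ ^ 2 < ∞) (a b : ℝ) : IntegrableOn u (Icc a b) := by
  refine ⟨hu.restrict, ?_⟩
  have h1 := lintegral_pow_two_le (volume.restrict (Icc a b)) hu.restrict.enorm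
  have h2 : (∫⁻ x in Icc a b, ‖u x‖ₑ) ^ 2 < ∞ := by
    refine h1.trans_lt (ENNReal.mul_lt_top (by simp) ?_)
    exact (setLIntegral_le_lintegral _ _).trans_lt h
  exact (ENNReal.pow_lt_top_iff.1 h2).resolve_right (by norm_num)

/-- The second difference of a function with square integrable second derivative. -/
theorem lintegral_second_difference_le {e e1 e2 : ℝ → ℝ} {s : Set ℝ} (hs : s.Countable)
    (he : Continuous e) (he1 : Continuous e1) (hd : ∀ x ∉ s, HasDerivAt e (e1 x) x)
    (hd1 : ∀ x ∉ s, HasDerivAt e1 (e2 x) x) (he2 : Measurable e2)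
    (hfin : ∫⁻ x, ‖e2 x‖ₑ ^ 2 < ∞) {h : ℝ} (hh : 0 < h) :
    ∫⁻ x, ‖e (x + h) - 2 * e x + e (x - h)‖ₑ ^ 2 ≤
      ENNReal.ofReal (4 * h ^ 4) * ∫⁻ x, ‖e2 x‖ₑ ^ 2 := by
  have hloc := integrableOn_of_lintegral_sq_lt_top he2.aestronglyMeasurable hfin
  -- Both arguments of `e1` in the integral representation lie in the window [x-h, x+h], so the
  -- increment of `e1` is at most the integral of |e2| over it. Squaring gives h², Cauchy–Schwarz on
  -- the window gives 2h, and integrating over all windows gives another 2h: in total 4h⁴.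
  have key : ∀ x, ‖e (x + h) - 2 * e x + e (x - h)‖ₑ ≤
      ENNReal.ofReal h * ∫⁻ t in Icc (x - h) (x + h), ‖e2 t‖ₑ := by
    intro x
    have hB : ∫⁻ t in Icc (x - h) (x + h), ‖e2 t‖ₑ ≠ ∞ := (hloc (x - h) (x + h)).2.ne
    have hrep : e (x + h) - 2 * e x + e (x - h) =
        ∫ r in (0 : ℝ)..h, (e1 (x + r) - e1 (x + r - h)) := by
      rw [integral_eq_of_hasDerivAt_off_countable_of_le (fun r => e (x + r) - e (x + r - h)) _
        hh.le (s := (fun r => x + r) ⁻¹' s ∪ (fun r => x + r - h) ⁻¹' s)]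
      · simp; ring
      · refine (hs.preimage fun a b hab => ?_).union (hs.preimage fun a b hab => ?_)
        · simpa using hab
        · simpa using hab
      · fun_prop
      · rintro r ⟨-, hr⟩
        simp only [mem_union, mem_preimage, not_or] at hr
        have h1 := (hd _ hr.1).scomp r ((hasDerivAt_id r).const_add x)
        have h2 := (hd _ hr.2).scomp r (((hasDerivAt_id r).const_add x).sub_const h)
        simp only [Function.comp_def, one_smul] at h1 h2
        exact h1.sub h2
      · exact Continuous.intervalIntegrable (by fun_prop) _ _
    have hb : ∀ r ∈ uIoc 0 h, ‖e1 (x + r) - e1 (x + r - h)‖ ≤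
        (∫⁻ t in Icc (x - h) (x + h), ‖e2 t‖ₑ).toReal := by
      intro r hr
      rw [uIoc_of_le hh.le] at hr
      have h1 : ‖e1 (x + r) - e1 (x + r - h)‖ₑ ≤ ∫⁻ t in Icc (x - h) (x + h), ‖e2 t‖ₑ := by
        refine (enorm_sub_le_lintegral_of_hasDerivAt_off_countable hs (by linarith)
          he1.continuousOn (fun y hy => hd1 y hy.2)
          ((hloc (x + r - h) (x + r)).mono_set Ioc_subset_Icc_self)).trans ?_
        exact lintegral_mono_set (Icc_subset_Icc (by linarith [hr.1]) (by linarith [hr.2]))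
      rw [← toReal_enorm]
      exact ENNReal.toReal_mono hB h1
    have h3 := intervalIntegral.norm_integral_le_of_norm_le_const hb
    rw [← hrep, sub_zero, abs_of_pos hh] at h3
    rw [← ofReal_norm]
    refine (ENNReal.ofReal_le_ofReal h3).trans ?_
    rw [mul_comm, ENNReal.ofReal_mul hh.le, ENNReal.ofReal_toReal hB]
  have key2 : ∀ x, ‖e (x + h) - 2 * e x + e (x - h)‖ₑ ^ 2 ≤
      ENNReal.ofReal (2 * h ^ 3) * ∫⁻ t in Icc (x - h) (x + h), ‖e2 t‖ₑ ^ 2 := by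
    intro x
    refine (pow_le_pow_left' (key x) 2).trans ?_
    rw [mul_pow]
    refine (mul_le_mul_right (lintegral_pow_two_le _ he2.enorm.aemeasurable.restrict) _).trans ?_
    rw [Measure.restrict_apply_univ, Real.volume_Icc, ← mul_assoc,
      ← ENNReal.ofReal_pow hh.le, ← ENNReal.ofReal_mul (by positivity)]
    refine le_of_eq ?_
    congr 2
    ring
  refine (lintegral_mono key2).trans ?_
  rw [lintegral_const_mul' _ _ ENNReal.ofReal_ne_top, lintegral_window (by fun_prop),
    ← mul_assoc, ← ENNReal.ofReal_mul (by positivity)]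
  refine le_of_eq ?_
  congr 2
  ring

theorem enorm_sq_eq_ofReal (a : ℝ) : ‖a‖ₑ ^ 2 = ENNReal.ofReal (a ^ 2) := by
  rw [← ofReal_norm, ← ENNReal.ofReal_pow (norm_nonneg _), Real.norm_eq_abs, sq_abs]

theorem lintegral_comp_const_add_mul {φ : ℝ → ℝ≥0∞} (hφ : Measurable φ) (b : ℝ) {a : ℝ}
    (ha : a ≠ 0) : ∫⁻ x, φ (b + a * x) = ENNReal.ofReal |a⁻¹| * ∫⁻ x, φ x := by
  have h1 : ∫⁻ x, φ (b + a * x) = ∫⁻ y, φ (b + y) ∂(Measure.map (fun x => a * x) volume) := by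
    rw [lintegral_map (by fun_prop) (by fun_prop)]
  rw [h1, Real.map_volume_mul_left ha, lintegral_smul_measure, smul_eq_mul,
    lintegral_add_left_eq_self (fun x => φ x)]

/-! ### C¹ functions on [0,1], clamped to the line. -/

/-- A `C¹` function on `[0,1]` with derivative `v1` whose derivative on `(0,1)` is `v2`; `v` and
`v1` are extended by constants and `v2` by zero. -/
structure IsClampedC2 (v v1 v2 : ℝ → ℝ) : Prop where
  cont : Continuous v
  left : ∀ x ≤ 0, v x = v 0
  right : ∀ x, 1 ≤ x → v x = v 1
  hasDeriv : ∀ x ∈ Ioo (0 : ℝ) 1, HasDerivAt v (v1 x) x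
  cont1 : Continuous v1
  left1 : ∀ x ≤ 0, v1 x = v1 0
  right1 : ∀ x, 1 ≤ x → v1 x = v1 1
  hasDeriv1 : ∀ x ∈ Ioo (0 : ℝ) 1, HasDerivAt v1 (v2 x) x
  meas2 : Measurable v2
  zero2 : ∀ x ∉ Ioo (0 : ℝ) 1, v2 x = 0

namespace IsClampedC2

variable {v v1 v2 : ℝ → ℝ}

theorem reflect (H : IsClampedC2 v v1 v2) :
    IsClampedC2 (fun x => v (1 - x)) (fun x => -v1 (1 - x)) (fun x => v2 (1 - x)) where
  cont := H.cont.comp (by fun_prop)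
  left x hx := by rw [H.right (1 - x) (by linarith)]; norm_num
  right x hx := by rw [H.left (1 - x) (by linarith)]; norm_num
  hasDeriv x hx := (H.hasDeriv (1 - x) ⟨by linarith [hx.2], by linarith [hx.1]⟩).comp_const_sub 1 x
  cont1 := (H.cont1.comp (by fun_prop)).neg
  left1 x hx := by rw [H.right1 (1 - x) (by linarith)]; norm_num
  right1 x hx := by rw [H.left1 (1 - x) (by linarith)]; norm_num
  hasDeriv1 x hx := by
    simpa using ((H.hasDeriv1 (1 - x)
      ⟨by linarith [hx.2], by linarith [hx.1]⟩).comp_const_sub 1 x).fun_neg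
  meas2 := H.meas2.comp (by fun_prop)
  zero2 x hx := H.zero2 _ fun h => hx ⟨by linarith [h.2], by linarith [h.1]⟩

theorem hasDerivAt (H : IsClampedC2 v v1 v2) {x : ℝ} (h0 : x ≠ 0) (h1 : x ≠ 1) :
    HasDerivAt v ((Ioo 0 1).indicator v1 x) x := by
  rcases lt_or_gt_of_ne h0 with h0 | h0
  · rw [indicator_of_notMem (by simp [h0.le])]
    exact (hasDerivAt_const x (v 0)).congr_of_eventuallyEq
      ((eventually_lt_nhds h0).mono fun y hy => H.left y hy.le)
  · rcases lt_or_gt_of_ne h1 with h1 | h1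
    · rw [indicator_of_mem (show x ∈ Ioo (0 : ℝ) 1 from ⟨h0, h1⟩)]
      exact H.hasDeriv x ⟨h0, h1⟩
    · rw [indicator_of_notMem (by simp [h1.le])]
      exact (hasDerivAt_const x (v 1)).congr_of_eventuallyEq
        ((eventually_gt_nhds h1).mono fun y hy => H.right y hy.le)

theorem hasDerivAt1 (H : IsClampedC2 v v1 v2) {x : ℝ} (h0 : x ≠ 0) (h1 : x ≠ 1) :
    HasDerivAt v1 (v2 x) x := by
  rcases lt_or_gt_of_ne h0 with h0 | h0
  · rw [H.zero2 _ (by simp [h0.le])]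
    exact (hasDerivAt_const x (v1 0)).congr_of_eventuallyEq
      ((eventually_lt_nhds h0).mono fun y hy => H.left1 y hy.le)
  · rcases lt_or_gt_of_ne h1 with h1 | h1
    · exact H.hasDeriv1 x ⟨h0, h1⟩
    · rw [H.zero2 _ (by simp [h1.le])]
      exact (hasDerivAt_const x (v1 1)).congr_of_eventuallyEq
        ((eventually_gt_nhds h1).mono fun y hy => H.right1 y hy.le)

/-- Pointwise bounds by the boundary values and the `L²` norm of the second derivative. -/
theorem exists_bound (H : IsClampedC2 v v1 v2) (hfin : ∫⁻ x, ‖v2 x‖ₑ ^ 2 < ∞) :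
    ∃ M : ℝ, 0 ≤ M ∧ (∀ x, |v x| ≤ M) ∧ (∀ x, |v1 x| ≤ M) ∧
      ENNReal.ofReal (M ^ 2) ≤
        12 * (‖v 0‖ₑ ^ 2 + ‖v 1‖ₑ ^ 2 + ∫⁻ x, ‖v2 x‖ₑ ^ 2) := by
  have hloc := integrableOn_of_lintegral_sq_lt_top H.meas2.aestronglyMeasurable hfin
  set J : ℝ≥0∞ := ∫⁻ t in Icc 0 1, ‖v2 t‖ₑ with hJ
  have hJfin : J ≠ ∞ := (hloc 0 1).2.ne
  set I := J.toReal with hI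
  have hI0 : 0 ≤ I := ENNReal.toReal_nonneg
  have hosc : ∀ a b, 0 ≤ a → a ≤ b → b ≤ 1 → |v1 b - v1 a| ≤ I := by
    intro a b ha hab hb
    have h1 := enorm_sub_le_lintegral_of_hasDerivAt_off_countable (s := ∅) countable_empty hab
      H.cont1.continuousOn
      (fun y hy => H.hasDeriv1 y ⟨by linarith [hy.1.1], by linarith [hy.1.2]⟩)
      ((hloc a b).mono_set Ioc_subset_Icc_self)
    have h2 : ‖v1 b - v1 a‖ₑ ≤ J := h1.trans (lintegral_mono_set (Icc_subset_Icc ha hb))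
    rw [← Real.norm_eq_abs, ← toReal_enorm]
    exact ENNReal.toReal_mono hJfin h2
  -- At `ξ` the derivative equals the chord slope v(1) - v(0). Together with the oscillation bound
  -- `I` this controls `v1`, and then `v`, by boundary values and `v2` alone.
  obtain ⟨ξ, hξ, hξ'⟩ := exists_hasDerivAt_eq_slope v v1 one_pos H.cont.continuousOn
    (fun x hx => H.hasDeriv x hx)
  have hb1 : ∀ x ∈ Icc (0 : ℝ) 1, |v1 x| ≤ |v 0| + |v 1| + I := by
    intro x hx
    have h1 : |v1 x - v1 ξ| ≤ I := by
      rcases le_total x ξ with h | h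
      · rw [abs_sub_comm]; exact hosc _ _ hx.1 h hξ.2.le
      · exact hosc _ _ hξ.1.le h hx.2
    have h2 : |v1 ξ| ≤ |v 0| + |v 1| := by
      rw [hξ', sub_zero, div_one, add_comm]; exact abs_sub _ _
    calc |v1 x| = |(v1 x - v1 ξ) + v1 ξ| := by ring_nf
      _ ≤ _ := by linarith [abs_add_le (v1 x - v1 ξ) (v1 ξ)]
  have hb : ∀ x ∈ Icc (0 : ℝ) 1, |v x| ≤ 2 * |v 0| + |v 1| + I := by
    intro x hx
    rcases hx.1.eq_or_lt with rfl | h0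
    · linarith [abs_nonneg (v 0), abs_nonneg (v 1)]
    obtain ⟨η, hη, hη'⟩ := exists_hasDerivAt_eq_slope v v1 h0 H.cont.continuousOn
      (fun y hy => H.hasDeriv y ⟨hy.1, by linarith [hy.2, hx.2]⟩)
    have h1 := hb1 η ⟨hη.1.le, by linarith [hη.2, hx.2]⟩
    have h2 : v x = v 0 + v1 η * x := by
      rw [hη']; field_simp; ring
    have h3 : |v1 η * x| ≤ |v1 η| := by
      rw [abs_mul, abs_of_pos h0]
      exact mul_le_of_le_one_right (abs_nonneg _) hx.2
    rw [h2]
    linarith [abs_add_le (v 0) (v1 η * x)]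
  have hI2 : ENNReal.ofReal (I ^ 2) ≤ ∫⁻ x, ‖v2 x‖ₑ ^ 2 := by
    rw [ENNReal.ofReal_pow hI0, hI, ENNReal.ofReal_toReal hJfin]
    refine (lintegral_pow_two_le _ H.meas2.enorm.aemeasurable.restrict).trans ?_
    simp only [Measure.restrict_apply_univ, Real.volume_Icc, sub_zero, ENNReal.ofReal_one, one_mul]
    exact setLIntegral_le_lintegral _ _
  refine ⟨2 * |v 0| + |v 1| + I, by positivity, fun x => ?_, fun x => ?_, ?_⟩
  · rcases le_total x 0 with h | h
    · rw [H.left x h]; exact hb 0 (by simp)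
    · rcases le_total x 1 with h' | h'
      · exact hb x ⟨h, h'⟩
      · rw [H.right x h']; exact hb 1 (by simp)
  · refine le_trans (b := |v 0| + |v 1| + I) ?_ (by linarith [abs_nonneg (v 0)])
    rcases le_total x 0 with h | h
    · rw [H.left1 x h]; exact hb1 0 (by simp)
    · rcases le_total x 1 with h' | h'
      · exact hb1 x ⟨h, h'⟩
      · rw [H.right1 x h']; exact hb1 1 (by simp)
  · refine le_trans (b := ENNReal.ofReal (12 * (v 0 ^ 2 + v 1 ^ 2 + I ^ 2))) ?_ ?_
    · refine ENNReal.ofReal_le_ofReal ?_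
      have e0 := sq_abs (v 0)
      have e1 := sq_abs (v 1)
      nlinarith [sq_nonneg (2 * |v 0| - |v 1|), sq_nonneg (2 * |v 0| - I), sq_nonneg (|v 1| - I)]
    · rw [ENNReal.ofReal_mul (by norm_num), ENNReal.ofReal_add (by positivity) (by positivity),
        ENNReal.ofReal_add (by positivity) (by positivity), enorm_sq_eq_ofReal, enorm_sq_eq_ofReal]
      norm_num
      gcongr

end IsClampedC2

/-! ### Cutoff and reflection extension in one variable. -/

/-- A `C¹` cutoff, equal to `1` on `[0,∞)` and to `0` on `(-∞,-1/2]`. -/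
noncomputable def cutoff (x : ℝ) : ℝ := (1 - 4 * (max (-1 / 2) (min x 0)) ^ 2) ^ 2

/-- The derivative of `cutoff`. -/
noncomputable def cutoff1 (x : ℝ) : ℝ :=
  -16 * max (-1 / 2) (min x 0) * (1 - 4 * (max (-1 / 2) (min x 0)) ^ 2)

/-- The almost everywhere second derivative of `cutoff`. -/
noncomputable def cutoff2 (x : ℝ) : ℝ :=
  (Ioo (-1 / 2) (0 : ℝ)).indicator (fun x => -16 + 192 * x ^ 2) x

theorem continuous_cutoff : Continuous cutoff := by unfold cutoff; fun_prop

theorem continuous_cutoff1 : Continuous cutoff1 := by unfold cutoff1; fun_prop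

theorem measurable_cutoff2 : Measurable cutoff2 := by
  unfold cutoff2
  exact Measurable.indicator (by fun_prop) measurableSet_Ioo

theorem cutoff_of_nonneg {x : ℝ} (hx : 0 ≤ x) : cutoff x = 1 := by
  simp only [cutoff, min_eq_right hx]; norm_num

theorem cutoff_of_le {x : ℝ} (hx : x ≤ -1 / 2) : cutoff x = 0 := by
  simp only [cutoff, min_eq_left (show x ≤ 0 by linarith), max_eq_left hx]; norm_num

theorem cutoff1_of_nonneg {x : ℝ} (hx : 0 ≤ x) : cutoff1 x = 0 := by
  simp only [cutoff1, min_eq_right hx]; norm_num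

theorem cutoff1_of_le {x : ℝ} (hx : x ≤ -1 / 2) : cutoff1 x = 0 := by
  simp only [cutoff1, min_eq_left (show x ≤ 0 by linarith), max_eq_left hx]; norm_num

theorem cutoff_mem_Icc (x : ℝ) : cutoff x ∈ Icc (0 : ℝ) 1 := by
  unfold cutoff
  have h1 : -1 / 2 ≤ max (-1 / 2) (min x 0) := le_max_left _ _
  have h2 : max (-1 / 2) (min x 0) ≤ 0 := max_le (by norm_num) (min_le_right _ _)
  refine ⟨sq_nonneg _, ?_⟩
  have h3 : (max (-1 / 2) (min x 0)) ^ 2 ≤ 1 / 4 := by nlinarith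
  nlinarith [sq_nonneg (max (-1 / 2) (min x 0))]

theorem abs_cutoff1_le (x : ℝ) : |cutoff1 x| ≤ 8 := by
  unfold cutoff1
  have h1 : -1 / 2 ≤ max (-1 / 2) (min x 0) := le_max_left _ _
  have h2 : max (-1 / 2) (min x 0) ≤ 0 := max_le (by norm_num) (min_le_right _ _)
  set c := max (-1 / 2) (min x 0)
  have h3 : c ^ 2 ≤ 1 / 4 := by nlinarith
  rw [abs_mul, abs_mul, abs_of_nonpos h2, abs_of_nonneg (by linarith : 0 ≤ 1 - 4 * c ^ 2)]
  norm_num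
  nlinarith [sq_nonneg c]

theorem abs_cutoff2_le (x : ℝ) : |cutoff2 x| ≤ 32 := by
  unfold cutoff2
  by_cases hx : x ∈ Ioo (-1 / 2) (0 : ℝ)
  · rw [indicator_of_mem hx, abs_le]
    constructor <;> nlinarith [hx.1, hx.2, sq_nonneg x]
  · rw [indicator_of_notMem hx]; norm_num

theorem hasDerivAt_cutoff {x : ℝ} (h0 : x ≠ 0) (h1 : x ≠ -1 / 2) :
    HasDerivAt cutoff (cutoff1 x) x ∧ HasDerivAt cutoff1 (cutoff2 x) x := by
  rcases lt_or_gt_of_ne h1 with h1 | h1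
  · have h2 : cutoff2 x = 0 := indicator_of_notMem (by simp [h1.le]) _
    rw [h2, cutoff1_of_le h1.le]
    exact ⟨(hasDerivAt_const x (0 : ℝ)).congr_of_eventuallyEq
        ((eventually_lt_nhds h1).mono fun y hy => cutoff_of_le hy.le),
      (hasDerivAt_const x (0 : ℝ)).congr_of_eventuallyEq
        ((eventually_lt_nhds h1).mono fun y hy => cutoff1_of_le hy.le)⟩
  rcases lt_or_gt_of_ne h0 with h0 | h0
  · have h2 : cutoff2 x = -16 + 192 * x ^ 2 := indicator_of_mem (show x ∈ Ioo _ _ from ⟨h1, h0⟩) _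
    have hc : ∀ y, y ∈ Ioo (-1 / 2) (0 : ℝ) → max (-1 / 2) (min y 0) = y := fun y hy => by
      rw [min_eq_left hy.2.le, max_eq_right hy.1.le]
    have hn : Ioo (-1 / 2) (0 : ℝ) ∈ 𝓝 x := Ioo_mem_nhds h1 h0
    have hsq : HasDerivAt (fun y : ℝ => 1 - 4 * y ^ 2) (-(8 * x)) x := by
      refine ((((hasDerivAt_id x).pow 2).const_mul 4).const_sub 1).congr_deriv ?_
      simp; ring
    constructor
    · have h3 : HasDerivAt (fun y : ℝ => (1 - 4 * y ^ 2) ^ 2) (cutoff1 x) x := by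
        refine (hsq.pow 2).congr_deriv ?_
        rw [cutoff1, hc x ⟨h1, h0⟩]; simp; ring
      exact h3.congr_of_eventuallyEq (eventually_of_mem hn fun y hy => by
        simp only [cutoff, hc y hy])
    · have h3 : HasDerivAt (fun y : ℝ => -16 * y * (1 - 4 * y ^ 2)) (cutoff2 x) x := by
        refine (((hasDerivAt_id x).const_mul (-16)).mul hsq).congr_deriv ?_
        rw [h2]; simp; ring
      exact h3.congr_of_eventuallyEq (eventually_of_mem hn fun y hy => by
        simp only [cutoff1, hc y hy])
  · have h2 : cutoff2 x = 0 := indicator_of_notMem (by simp [h0.le]) _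
    rw [h2, cutoff1_of_nonneg h0.le]
    exact ⟨(hasDerivAt_const x (1 : ℝ)).congr_of_eventuallyEq
        ((eventually_gt_nhds h0).mono fun y hy => cutoff_of_nonneg hy.le),
      (hasDerivAt_const x (0 : ℝ)).congr_of_eventuallyEq
        ((eventually_gt_nhds h0).mono fun y hy => cutoff1_of_nonneg hy.le)⟩

/-- The correction which extends a function on `[0,∞)`, constant on `(-∞,0]`, by a two-point
reflection with cutoff to the left of `0`. -/
noncomputable def halfExt (v : ℝ → ℝ) (x : ℝ) : ℝ :=
  cutoff x * (3 * v (-x) - 2 * v (-2 * x)) - v 0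

/-- The continuous part of the derivative of `halfExt`. -/
noncomputable def halfExt1 (v v1 : ℝ → ℝ) (x : ℝ) : ℝ :=
  cutoff1 x * (3 * v (-x) - 2 * v (-2 * x)) + cutoff x * (-3 * v1 (-x) + 4 * v1 (-2 * x)) - v1 0

/-- The derivative of `halfExt1`. -/
noncomputable def halfExt2 (v v1 v2 : ℝ → ℝ) (x : ℝ) : ℝ :=
  cutoff2 x * (3 * v (-x) - 2 * v (-2 * x))
    + cutoff1 x * (-3 * (Ioo 0 1).indicator v1 (-x) + 4 * (Ioo 0 1).indicator v1 (-2 * x))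
    + cutoff1 x * (-3 * v1 (-x) + 4 * v1 (-2 * x))
    + cutoff x * (3 * v2 (-x) - 8 * v2 (-2 * x))

/-- Hestenes-type extension with cutoff of a function on `[0,1]` (extended by constants) to a
compactly supported function on the line. -/
noncomputable def hestenes (v : ℝ → ℝ) (x : ℝ) : ℝ :=
  v x + halfExt v x + halfExt (fun y => v (1 - y)) (1 - x)

/-- The weights of the reflection are chosen so that 3 - 2 = 1 and -3 + 4 = 1: value and first
derivative match at 0. The value condition makes the correction vanish on the right of 0. -/
theorem halfExt_of_nonneg {v : ℝ → ℝ} (hl : ∀ x ≤ 0, v x = v 0) {x : ℝ} (hx : 0 ≤ x) :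
    halfExt v x = 0 := by
  rw [halfExt, cutoff_of_nonneg hx, hl (-x) (by linarith), hl (-2 * x) (by linarith)]
  ring

theorem halfExt_reflect_of_le {v : ℝ → ℝ} (hr : ∀ x, 1 ≤ x → v x = v 1) {x : ℝ} (hx : x ≤ 1) :
    halfExt (fun y => v (1 - y)) (1 - x) = 0 :=
  halfExt_of_nonneg (v := fun y => v (1 - y))
    (fun y hy => by simpa using hr (1 - y) (by linarith)) (by linarith)

theorem hestenes_of_mem {v : ℝ → ℝ} (hl : ∀ x ≤ 0, v x = v 0) (hr : ∀ x, 1 ≤ x → v x = v 1)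
    {x : ℝ} (hx : x ∈ Icc (0 : ℝ) 1) : hestenes v x = v x := by
  rw [hestenes, halfExt_of_nonneg hl hx.1, halfExt_reflect_of_le hr hx.2, add_zero, add_zero]

theorem cutoff_mul_sq_le (c a b : ℝ) (h : c ∈ Icc (0 : ℝ) 1) :
    (c * (3 * a - 2 * b)) ^ 2 ≤ 18 * (a ^ 2 + b ^ 2) := by
  have h1 : c ^ 2 ≤ 1 := by nlinarith [h.1, h.2]
  rw [mul_pow]
  nlinarith [sq_nonneg (3 * a + 2 * b), mul_nonneg (sub_nonneg.2 h1) (sq_nonneg (3 * a - 2 * b))]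

/-- The cutoff vanishes left of -1/2, and right of it both -x and -2x lie in [0,1], so only values
of `v` on the unit interval enter. The factor 18 comes from (3a - 2b)² ≤ 18(a² + b²). -/
theorem halfExt_add_sq_le {v : ℝ → ℝ} {x : ℝ} (hx : x < 0) :
    (halfExt v x + v 0) ^ 2 ≤ 18 * ((Icc 0 1).indicator (fun y => v y ^ 2) (-x) +
      (Icc 0 1).indicator (fun y => v y ^ 2) (-2 * x)) := by
  rw [halfExt, sub_add_cancel]
  rcases le_or_gt x (-1 / 2) with h | h
  · rw [cutoff_of_le h]
    have h1 : ∀ z, 0 ≤ (Icc (0 : ℝ) 1).indicator (fun y => v y ^ 2) z := fun z =>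
      indicator_nonneg (fun y _ => sq_nonneg _) z
    have := h1 (-x)
    have := h1 (-2 * x)
    nlinarith
  · rw [indicator_of_mem (show -x ∈ Icc (0 : ℝ) 1 from ⟨by linarith, by linarith⟩),
      indicator_of_mem (show -2 * x ∈ Icc (0 : ℝ) 1 from ⟨by linarith, by linarith⟩)]
    exact cutoff_mul_sq_le _ _ _ (cutoff_mem_Icc x)

/-- The five arguments are the point itself, its two images under the reflection at 0, and its two
images under the reflection at 1. After integration each term contributes at most the L² mass of `v`
on [0,1], which gives the factor 5 · 18 = 90 below. -/
theorem hestenes_sq_le {v : ℝ → ℝ} (hl : ∀ x ≤ 0, v x = v 0) (hr : ∀ x, 1 ≤ x → v x = v 1)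
    (x : ℝ) : hestenes v x ^ 2 ≤ 18 * ((Icc 0 1).indicator (fun y => v y ^ 2) x +
      (Icc 0 1).indicator (fun y => v y ^ 2) (-x) +
      (Icc 0 1).indicator (fun y => v y ^ 2) (-2 * x) +
      (Icc 0 1).indicator (fun y => v y ^ 2) (2 - x) +
      (Icc 0 1).indicator (fun y => v y ^ 2) (3 - 2 * x)) := by
  have h1 : ∀ z, 0 ≤ (Icc (0 : ℝ) 1).indicator (fun y => v y ^ 2) z := fun z =>
    indicator_nonneg (fun y _ => sq_nonneg _) z
  have p1 := h1 x
  have p2 := h1 (-x)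
  have p3 := h1 (-2 * x)
  have p4 := h1 (2 - x)
  have p5 := h1 (3 - 2 * x)
  rcases lt_or_ge x 0 with h | h
  · have h2 := halfExt_add_sq_le (v := v) h
    rw [hestenes, halfExt_reflect_of_le hr (by linarith), hl x h.le, add_zero, add_comm (v 0)]
    linarith
  rcases le_or_gt x 1 with h' | h'
  · rw [hestenes_of_mem hl hr ⟨h, h'⟩, indicator_of_mem (show x ∈ Icc (0 : ℝ) 1 from ⟨h, h'⟩)]
    have := sq_nonneg (v x)
    linarith
  · have h2 := halfExt_add_sq_le (v := fun y => v (1 - y)) (x := 1 - x) (by linarith)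
    have h3 : ∀ z, (Icc (0 : ℝ) 1).indicator (fun y => v (1 - y) ^ 2) z =
        (Icc (0 : ℝ) 1).indicator (fun y => v y ^ 2) (1 - z) := by
      intro z
      simp only [indicator, mem_Icc]
      congr 1
      apply propext
      constructor <;> rintro ⟨h1, h2⟩ <;> constructor <;> linarith
    rw [h3, h3, show 1 - -(1 - x) = 2 - x by ring, show 1 - -2 * (1 - x) = 3 - 2 * x by ring,
      sub_zero] at h2
    rw [hestenes, halfExt_of_nonneg hl h, hr x h'.le, add_zero, add_comm (v 1)]
    linarith

theorem lintegral_hestenes_sq_le {v : ℝ → ℝ} (hv : Measurable v) (hl : ∀ x ≤ 0, v x = v 0)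
    (hr : ∀ x, 1 ≤ x → v x = v 1) :
    ∫⁻ x, ‖hestenes v x‖ₑ ^ 2 ≤ 90 * ∫⁻ x in Icc 0 1, ‖v x‖ₑ ^ 2 := by
  set φ : ℝ → ℝ≥0∞ := (Icc 0 1).indicator fun x => ‖v x‖ₑ ^ 2 with hφ
  have hφm : Measurable φ := Measurable.indicator (by fun_prop) measurableSet_Icc
  have hφe : ∀ x, ENNReal.ofReal ((Icc 0 1).indicator (fun y => v y ^ 2) x) = φ x := by
    intro x
    by_cases hx : x ∈ Icc (0 : ℝ) 1
    · rw [indicator_of_mem hx, hφ, indicator_of_mem hx, enorm_sq_eq_ofReal]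
    · rw [indicator_of_notMem hx, hφ, indicator_of_notMem hx, ENNReal.ofReal_zero]
  have hp : ∀ x, ‖hestenes v x‖ₑ ^ 2 ≤ 18 * (φ (0 + 1 * x) + φ (0 + (-1) * x) +
      φ (0 + (-2) * x) + φ (2 + (-1) * x) + φ (3 + (-2) * x)) := by
    intro x
    have h1 : ∀ z, 0 ≤ (Icc (0 : ℝ) 1).indicator (fun y => v y ^ 2) z := fun z =>
      indicator_nonneg (fun y _ => sq_nonneg _) z
    rw [enorm_sq_eq_ofReal]
    refine (ENNReal.ofReal_le_ofReal (hestenes_sq_le hl hr x)).trans ?_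
    have a1 := h1 x
    have a2 := h1 (-x)
    have a3 := h1 (-2 * x)
    have a4 := h1 (2 - x)
    have a5 := h1 (3 - 2 * x)
    rw [ENNReal.ofReal_mul (by norm_num), ENNReal.ofReal_add (by positivity) (by positivity),
      ENNReal.ofReal_add (by positivity) (by positivity),
      ENNReal.ofReal_add (by positivity) (by positivity),
      ENNReal.ofReal_add (by positivity) (by positivity)]
    simp only [hφe]
    rw [show ENNReal.ofReal 18 = 18 by simp, show 0 + 1 * x = x by ring,
      show 0 + -1 * x = -x by ring, show 0 + -2 * x = -2 * x by ring,
      show 2 + -1 * x = 2 - x by ring, show 3 + -2 * x = 3 - 2 * x by ring]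
  refine (lintegral_mono hp).trans ?_
  rw [lintegral_const_mul _ (by fun_prop), lintegral_add_left (by fun_prop),
    lintegral_add_left (by fun_prop), lintegral_add_left (by fun_prop),
    lintegral_add_left (by fun_prop), lintegral_comp_const_add_mul hφm _ (by norm_num),
    lintegral_comp_const_add_mul hφm _ (by norm_num),
    lintegral_comp_const_add_mul hφm _ (by norm_num),
    lintegral_comp_const_add_mul hφm _ (by norm_num),
    lintegral_comp_const_add_mul hφm _ (by norm_num), hφ, lintegral_indicator measurableSet_Icc]
  set I := ∫⁻ x in Icc 0 1, ‖v x‖ₑ ^ 2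
  have h1 : ∀ a : ℝ, |a⁻¹| ≤ 1 → ENNReal.ofReal |a⁻¹| * I ≤ I := fun a ha =>
    mul_le_of_le_one_left' (ENNReal.ofReal_le_one.2 ha)
  calc _ ≤ 18 * (I + I + I + I + I) := by
        gcongr <;> refine h1 _ ?_ <;> norm_num [abs_le]
    _ = 90 * I := by ring

namespace IsClampedC2

variable {v v1 v2 : ℝ → ℝ}

theorem continuous_halfExt (H : IsClampedC2 v v1 v2) : Continuous (halfExt v) := by
  have h := continuous_cutoff
  have h1 := H.cont
  unfold halfExt
  fun_prop

theorem continuous_halfExt1 (H : IsClampedC2 v v1 v2) : Continuous (halfExt1 v v1) := by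
  have h := continuous_cutoff
  have h1 := H.cont
  have h2 := H.cont1
  have h3 := continuous_cutoff1
  unfold halfExt1
  fun_prop

theorem measurable_halfExt2 (H : IsClampedC2 v v1 v2) : Measurable (halfExt2 v v1 v2) := by
  have h := continuous_cutoff.measurable
  have h1 := H.cont.measurable
  have h2 := H.cont1.measurable
  have h3 := continuous_cutoff1.measurable
  have h4 := H.meas2
  have h5 := measurable_cutoff2
  have h6 : Measurable ((Ioo (0 : ℝ) 1).indicator v1) := h2.indicator measurableSet_Ioo
  unfold halfExt2
  fun_prop

theorem hasDerivAt_halfExt_aux (H : IsClampedC2 v v1 v2) {x : ℝ} (h0 : x ≠ 0) (h1 : x ≠ -1 / 2)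
    (h2 : x ≠ -1) : HasDerivAt (fun x => 3 * v (-x) - 2 * v (-2 * x))
      (-3 * (Ioo 0 1).indicator v1 (-x) + 4 * (Ioo 0 1).indicator v1 (-2 * x)) x := by
  have d1 : HasDerivAt (fun x => v (-x)) (-(Ioo 0 1).indicator v1 (-x)) x := by
    have := (H.hasDerivAt (x := -x) (by simpa using h0) (fun h => h2 (by linarith))).comp x
      (hasDerivAt_neg x)
    exact this.congr_deriv (by ring)
  have d2 : HasDerivAt (fun x => v (-2 * x)) (-2 * (Ioo 0 1).indicator v1 (-2 * x)) x := by
    have := (H.hasDerivAt (x := -2 * x) (by simpa using h0) (fun h => h1 (by linarith))).comp x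
      ((hasDerivAt_id x).const_mul (-2))
    exact this.congr_deriv (by ring)
  exact ((d1.const_mul 3).sub (d2.const_mul 2)).congr_deriv (by ring)

/-- Left of 0 the clamped `v` is constant, while the clamped `v1` keeps the value `v1 0`.
Subtracting `v1 0` in `halfExt1` compensates for this, so the corrected `v1` is a continuous
derivative of the extension across 0. -/
theorem hasDerivAt_halfExt (H : IsClampedC2 v v1 v2) {x : ℝ} (h0 : x ≠ 0) (h1 : x ≠ -1 / 2)
    (h2 : x ≠ -1) :
    HasDerivAt (halfExt v) (halfExt1 v v1 x + if x < 0 then v1 0 else 0) x := by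
  refine (((hasDerivAt_cutoff h0 h1).1.mul (H.hasDerivAt_halfExt_aux h0 h1 h2)).sub_const
    (v 0)).congr_deriv ?_
  rw [halfExt1]
  rcases lt_or_gt_of_ne h0 with h0 | h0
  · rw [if_pos h0]
    rcases lt_or_gt_of_ne h1 with h1 | h1
    · rw [cutoff_of_le h1.le]; ring
    · rw [indicator_of_mem (show -x ∈ Ioo (0 : ℝ) 1 from ⟨by linarith, by linarith⟩),
        indicator_of_mem (show -2 * x ∈ Ioo (0 : ℝ) 1 from ⟨by linarith, by linarith⟩)]
      ring
  · rw [if_neg h0.not_gt, indicator_of_notMem (fun h => by linarith [h.1]),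
      indicator_of_notMem (fun h => by linarith [h.1]), H.left1 (-x) (by linarith),
      H.left1 (-2 * x) (by linarith), cutoff_of_nonneg h0.le]
    ring

theorem hasDerivAt_halfExt1 (H : IsClampedC2 v v1 v2) {x : ℝ} (h0 : x ≠ 0) (h1 : x ≠ -1 / 2)
    (h2 : x ≠ -1) : HasDerivAt (halfExt1 v v1) (halfExt2 v v1 v2 x) x := by
  have d1 : HasDerivAt (fun x => v1 (-x)) (-v2 (-x)) x := by
    have := (H.hasDerivAt1 (x := -x) (by simpa using h0) (fun h => h2 (by linarith))).comp x
      (hasDerivAt_neg x)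
    exact this.congr_deriv (by ring)
  have d2 : HasDerivAt (fun x => v1 (-2 * x)) (-2 * v2 (-2 * x)) x := by
    have := (H.hasDerivAt1 (x := -2 * x) (by simpa using h0) (fun h => h1 (by linarith))).comp x
      ((hasDerivAt_id x).const_mul (-2))
    exact this.congr_deriv (by ring)
  obtain ⟨c1, c2⟩ := hasDerivAt_cutoff h0 h1
  refine (((c2.mul (H.hasDerivAt_halfExt_aux h0 h1 h2)).add
    (c1.mul ((d1.const_mul (-3)).add (d2.const_mul 4)))).sub_const (v1 0)).congr_deriv ?_
  rw [halfExt2]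
  simp only [Pi.add_apply]
  ring

/-- Terms containing a derivative of the cutoff live on [-1/2, 0] and are at most (32·5 + 8·7 +
8·7)M = 272M. The factor 3 comes from squaring a sum of three terms, whence also 27 = 3·3² and 192 =
3·8². -/
theorem halfExt2_sq_le {M : ℝ} (hM : 0 ≤ M) (hv : ∀ x, |v x| ≤ M) (hv1 : ∀ x, |v1 x| ≤ M)
    (x : ℝ) : halfExt2 v v1 v2 x ^ 2 ≤
      (Icc (-1 / 2) (0 : ℝ)).indicator (fun _ => 3 * (272 * M) ^ 2) x
        + 27 * v2 (-x) ^ 2 + 192 * v2 (-2 * x) ^ 2 := by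
  have hD : ∀ y, |(Ioo (0 : ℝ) 1).indicator v1 y| ≤ M := fun y => by
    by_cases hy : y ∈ Ioo (0 : ℝ) 1
    · rw [indicator_of_mem hy]; exact hv1 y
    · rw [indicator_of_notMem hy]; simpa using hM
  have hc := cutoff_mem_Icc x
  have hc2 : cutoff x ^ 2 ≤ 1 := by nlinarith [hc.1, hc.2]
  have key : ∀ r : ℝ, (r + cutoff x * (3 * v2 (-x) - 8 * v2 (-2 * x))) ^ 2 ≤
      3 * r ^ 2 + 27 * v2 (-x) ^ 2 + 192 * v2 (-2 * x) ^ 2 := by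
    intro r
    have : ∀ a b : ℝ, (r + (a - b)) ^ 2 ≤ 3 * r ^ 2 + 3 * a ^ 2 + 3 * b ^ 2 := fun a b => by
      nlinarith [sq_nonneg (r - a), sq_nonneg (r + b), sq_nonneg (a + b)]
    have h1 := this (cutoff x * (3 * v2 (-x))) (cutoff x * (8 * v2 (-2 * x)))
    rw [← mul_sub, mul_pow, mul_pow (cutoff x)] at h1
    nlinarith [mul_nonneg (sub_nonneg.2 hc2) (sq_nonneg (3 * v2 (-x))),
      mul_nonneg (sub_nonneg.2 hc2) (sq_nonneg (8 * v2 (-2 * x)))]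
  rw [halfExt2]
  by_cases hx : x ∈ Icc (-1 / 2) (0 : ℝ)
  · rw [indicator_of_mem hx]
    refine (key _).trans ?_
    gcongr 3 * ?_ + _ + _
    rw [sq_le_sq, abs_of_nonneg (by positivity : 0 ≤ 272 * M)]
    have lin : ∀ a b p q : ℝ, |a| ≤ M → |b| ≤ M → |p * a + q * b| ≤ (|p| + |q|) * M := by
      intro a b p q ha hb
      refine (abs_add_le _ _).trans ?_
      rw [abs_mul, abs_mul, add_mul]
      gcongr
    have b1 : |3 * v (-x) - 2 * v (-2 * x)| ≤ 5 * M := by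
      have := lin _ _ 3 (-2) (hv (-x)) (hv (-2 * x))
      rw [neg_mul 2 (v _), ← sub_eq_add_neg] at this
      exact this.trans_eq (by norm_num)
    have b2 := (lin _ _ (-3) 4 (hD (-x)) (hD (-2 * x))).trans_eq
      (show _ = 7 * M by norm_num)
    have b3 := (lin _ _ (-3) 4 (hv1 (-x)) (hv1 (-2 * x))).trans_eq
      (show _ = 7 * M by norm_num)
    have m1 := mul_le_mul (abs_cutoff2_le x) b1 (abs_nonneg _) (by norm_num)
    have m2 := mul_le_mul (abs_cutoff1_le x) b2 (abs_nonneg _) (by norm_num)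
    have m3 := mul_le_mul (abs_cutoff1_le x) b3 (abs_nonneg _) (by norm_num)
    rw [← abs_mul] at m1 m2 m3
    refine (abs_add_three _ _ _).trans ?_
    linarith
  · rw [indicator_of_notMem hx]
    have h2 : cutoff2 x = 0 := indicator_of_notMem (fun h => hx ⟨h.1.le, h.2.le⟩) _
    have h1 : cutoff1 x = 0 := by
      rcases le_or_gt x (-1 / 2) with h | h
      · exact cutoff1_of_le h
      · exact cutoff1_of_nonneg (by
          by_contra hc
          exact hx ⟨h.le, (not_le.1 hc).le⟩)
    rw [h2, h1]
    have := key 0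
    simpa using this

theorem lintegral_halfExt2_sq_le (H : IsClampedC2 v v1 v2) {M : ℝ} (hM : 0 ≤ M)
    (hv : ∀ x, |v x| ≤ M) (hv1 : ∀ x, |v1 x| ≤ M) :
    ∫⁻ x, ‖halfExt2 v v1 v2 x‖ₑ ^ 2 ≤
      300000 * (ENNReal.ofReal (M ^ 2) + ∫⁻ x, ‖v2 x‖ₑ ^ 2) := by
  have hm := H.meas2
  set φ : ℝ → ℝ≥0∞ := fun x => ‖v2 x‖ₑ ^ 2 with hφ
  have hφm : Measurable φ := by fun_prop
  have hp : ∀ x, ‖halfExt2 v v1 v2 x‖ₑ ^ 2 ≤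
      (Icc (-1 / 2) (0 : ℝ)).indicator (fun _ => ENNReal.ofReal (3 * (272 * M) ^ 2)) x
        + 27 * φ (0 + (-1) * x) + 192 * φ (0 + (-2) * x) := by
    intro x
    rw [enorm_sq_eq_ofReal]
    refine (ENNReal.ofReal_le_ofReal (halfExt2_sq_le hM hv hv1 x)).trans ?_
    have h0 : 0 ≤ (Icc (-1 / 2) (0 : ℝ)).indicator (fun _ => 3 * (272 * M) ^ 2) x :=
      indicator_nonneg (fun _ _ => by positivity) x
    rw [ENNReal.ofReal_add (by positivity) (by positivity),
      ENNReal.ofReal_add (by positivity) (by positivity), ENNReal.ofReal_mul (by norm_num),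
      ENNReal.ofReal_mul (by norm_num), ← enorm_sq_eq_ofReal, ← enorm_sq_eq_ofReal]
    refine le_of_eq ?_
    congr 1
    · congr 1
      · by_cases hx : x ∈ Icc (-1 / 2) (0 : ℝ)
        · rw [indicator_of_mem hx, indicator_of_mem hx]
        · rw [indicator_of_notMem hx, indicator_of_notMem hx, ENNReal.ofReal_zero]
      · simp [hφ]
    · simp [hφ]
  refine (lintegral_mono hp).trans ?_
  rw [lintegral_add_right _ (by fun_prop), lintegral_add_right _ (by fun_prop),
    lintegral_indicator measurableSet_Icc, lintegral_const_mul _ (by fun_prop),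
    lintegral_const_mul _ (by fun_prop), lintegral_comp_const_add_mul hφm _ (by norm_num),
    lintegral_comp_const_add_mul hφm _ (by norm_num), lintegral_const,
    Measure.restrict_apply_univ, Real.volume_Icc]
  set I := ∫⁻ x, φ x
  have h1 : ∀ a : ℝ, |a⁻¹| ≤ 1 → ENNReal.ofReal |a⁻¹| * I ≤ I := fun a ha =>
    mul_le_of_le_one_left' (ENNReal.ofReal_le_one.2 ha)
  calc _ ≤ ENNReal.ofReal (300000 * M ^ 2) + 27 * I + 192 * I := by
        gcongr
        · rw [← ENNReal.ofReal_mul (by positivity)]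
          refine ENNReal.ofReal_le_ofReal ?_
          nlinarith [sq_nonneg M]
        · refine h1 _ ?_; norm_num
        · refine h1 _ ?_; norm_num [abs_le]
    _ = 300000 * ENNReal.ofReal (M ^ 2) + 219 * I := by
        rw [ENNReal.ofReal_mul (by norm_num)]; norm_num; ring
    _ ≤ _ := by rw [mul_add]; gcongr; norm_num

/-- The second difference of the extension is of order `h²` in `L²`. -/
theorem lintegral_hestenes_second_difference_le (H : IsClampedC2 v v1 v2)
    (hfin : ∫⁻ x, ‖v2 x‖ₑ ^ 2 < ∞) {h : ℝ} (hh : 0 < h) :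
    ∫⁻ x, ‖hestenes v (x + h) - 2 * hestenes v x + hestenes v (x - h)‖ₑ ^ 2 ≤
      ENNReal.ofReal (10 ^ 9 * h ^ 4) *
        (‖v 0‖ₑ ^ 2 + ‖v 1‖ₑ ^ 2 + ∫⁻ x, ‖v2 x‖ₑ ^ 2) := by
  obtain ⟨M, hM, hvM, hv1M, hMle⟩ := H.exists_bound hfin
  have R := H.reflect
  set E := ‖v 0‖ₑ ^ 2 + ‖v 1‖ₑ ^ 2 + ∫⁻ x, ‖v2 x‖ₑ ^ 2 with hE
  set S := ∫⁻ x, ‖v2 x‖ₑ ^ 2 with hS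
  have hSE : S ≤ E := le_add_self
  have hEfin : E < ∞ := by
    rw [hE]
    refine ENNReal.add_lt_top.2 ⟨ENNReal.add_lt_top.2 ⟨?_, ?_⟩, hfin⟩ <;>
      exact ENNReal.pow_lt_top enorm_lt_top
  set e2 : ℝ → ℝ := fun x => v2 x + halfExt2 v v1 v2 x +
    halfExt2 (fun y => v (1 - y)) (fun y => -v1 (1 - y)) (fun y => v2 (1 - y)) (1 - x) with he2
  have hSr : ∫⁻ x, ‖v2 (1 - x)‖ₑ ^ 2 = S := by
    rw [hS, ← lintegral_sub_left_eq_self (fun x => ‖v2 x‖ₑ ^ 2) 1]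
  have he2m : Measurable e2 := by
    have m0 := H.meas2
    have m1 := H.measurable_halfExt2
    have m2 := R.measurable_halfExt2
    exact (m0.add m1).add (m2.comp (by fun_prop))
  have hbound : ∫⁻ x, ‖e2 x‖ₑ ^ 2 ≤ ENNReal.ofReal (2.5 * 10 ^ 8) * E := by
    have l1 := H.lintegral_halfExt2_sq_le hM hvM hv1M
    have l2 := R.lintegral_halfExt2_sq_le hM (fun x => hvM _) (fun x => by
      rw [abs_neg]; exact hv1M _)
    rw [hSr, ← lintegral_sub_left_eq_self _ (1 : ℝ)] at l2
    have hp : ∀ x, ‖e2 x‖ₑ ^ 2 ≤ 3 * (‖v2 x‖ₑ ^ 2 + ‖halfExt2 v v1 v2 x‖ₑ ^ 2 +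
      ‖halfExt2 (fun y => v (1 - y)) (fun y => -v1 (1 - y)) (fun y => v2 (1 - y)) (1 - x)‖ₑ ^ 2) := by
      intro x
      simp only [enorm_sq_eq_ofReal, he2]
      rw [← ENNReal.ofReal_add (by positivity) (by positivity),
        ← ENNReal.ofReal_add (by positivity) (by positivity),
        show (3 : ℝ≥0∞) = ENNReal.ofReal 3 by simp, ← ENNReal.ofReal_mul (by norm_num)]
      refine ENNReal.ofReal_le_ofReal ?_
      have : ∀ a b c : ℝ, (a + b + c) ^ 2 ≤ 3 * (a ^ 2 + b ^ 2 + c ^ 2) := fun a b c => by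
        nlinarith [sq_nonneg (a - b), sq_nonneg (b - c), sq_nonneg (a - c)]
      exact this _ _ _
    refine (lintegral_mono hp).trans ?_
    have m0 := H.meas2
    have m1 := H.measurable_halfExt2
    rw [lintegral_const_mul _ (by
      have m2 := R.measurable_halfExt2
      have m3 := m2.comp (show Measurable fun x : ℝ => 1 - x by fun_prop)
      exact ((m0.enorm.pow_const 2).add (m1.enorm.pow_const 2)).add (m3.enorm.pow_const 2)),
      lintegral_add_left (by fun_prop), lintegral_add_left (by fun_prop)]
    calc _ ≤ 3 * (E + 300000 * (12 * E + E) + 300000 * (12 * E + E)) := by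
          gcongr
          · refine l1.trans ?_
            gcongr
          · refine l2.trans ?_
            gcongr
      _ = 23400003 * E := by ring
      _ ≤ _ := by
          gcongr
          rw [show (23400003 : ℝ≥0∞) = ENNReal.ofReal 23400003 by simp]
          exact ENNReal.ofReal_le_ofReal (by norm_num)
  -- The exceptional points are the junctions 0 and 1, the points -1/2 and 3/2 where the cutoff ends
  -- and the doubled reflection reaches an endpoint, and -1 and 2 where the simple reflection does.
  have hmain := lintegral_second_difference_le (e := hestenes v) (e2 := e2)
    (e1 := fun x => v1 x + halfExt1 v v1 x -
      halfExt1 (fun y => v (1 - y)) (fun y => -v1 (1 - y)) (1 - x))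
    (s := {0, 1, -1, -1 / 2, 3 / 2, 2}) (Set.toFinite _).countable
    ?_ ?_ ?_ ?_ he2m (hbound.trans_lt (ENNReal.mul_lt_top ENNReal.ofReal_lt_top hEfin)) hh
  · refine hmain.trans ((mul_le_mul_right hbound _).trans ?_)
    rw [← mul_assoc, ← ENNReal.ofReal_mul (by positivity)]
    refine le_of_eq ?_
    congr 2
    ring
  · exact (H.cont.add H.continuous_halfExt).add (R.continuous_halfExt.comp (by fun_prop))
  · exact (H.cont1.add H.continuous_halfExt1).sub (R.continuous_halfExt1.comp (by fun_prop))
  · intro x hx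
    simp only [mem_insert_iff, mem_singleton_iff, not_or] at hx
    obtain ⟨x0, x1, x2, x3, x4, x5⟩ := hx
    have d1 := H.hasDerivAt x0 x1
    have d2 := H.hasDerivAt_halfExt x0 x3 x2
    have d3 := (R.hasDerivAt_halfExt (x := 1 - x) (fun h => x1 (by linarith))
      (fun h => x4 (by linarith)) (fun h => x5 (by linarith))).comp_const_sub 1 x
    refine ((d1.add d2).add d3).congr_deriv ?_
    rcases lt_or_gt_of_ne x0 with x0 | x0
    · rw [if_pos x0, if_neg (by linarith), indicator_of_notMem (fun h => by linarith [h.1]),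
        H.left1 x x0.le]
      ring
    rcases lt_or_gt_of_ne x1 with x1 | x1
    · rw [if_neg x0.not_gt, if_neg (by linarith), indicator_of_mem (show x ∈ Ioo (0:ℝ) 1 from ⟨x0, x1⟩)]
      ring
    · rw [if_neg x0.not_gt, if_pos (by linarith), indicator_of_notMem (fun h => by linarith [h.2]),
        H.right1 x x1.le]
      simp only [sub_zero]
      ring
  · intro x hx
    simp only [mem_insert_iff, mem_singleton_iff, not_or] at hx
    obtain ⟨x0, x1, x2, x3, x4, x5⟩ := hx
    have d1 := H.hasDerivAt1 x0 x1
    have d2 := H.hasDerivAt_halfExt1 x0 x3 x2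
    have d3 := (R.hasDerivAt_halfExt1 (x := 1 - x) (fun h => x1 (by linarith))
      (fun h => x4 (by linarith)) (fun h => x5 (by linarith))).comp_const_sub 1 x
    refine ((d1.add d2).sub d3).congr_deriv ?_
    simp only [he2]
    ring

end IsClampedC2

/-! ### Extension to the plane and its second differences. -/

/-- A function of two variables, with clamped `C²` sections in the first variable and a square
integrable second partial derivative. -/
structure IsClampedX (F p1 p2 : ℝ × ℝ → ℝ) : Prop where
  c2 : ∀ y, IsClampedC2 (fun x => F (x, y)) (fun x => p1 (x, y)) (fun x => p2 (x, y))
  meas : AEMeasurable (fun y => ∫⁻ x, ‖p2 (x, y)‖ₑ ^ 2) (volume.restrict (Icc 0 1))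
  fin : ∫⁻ y in Icc 0 1, ∫⁻ x, ‖p2 (x, y)‖ₑ ^ 2 < ∞

/-- The extension of a function on the square to a compactly supported function on the plane. -/
noncomputable def hestenes2 (F : ℝ × ℝ → ℝ) (p : ℝ × ℝ) : ℝ :=
  hestenes (fun y => hestenes (fun x => F (x, y)) p.1) p.2

theorem hestenes2_swap (F : ℝ × ℝ → ℝ) (p : ℝ × ℝ) :
    hestenes2 (fun q => F q.swap) p.swap = hestenes2 F p := by
  simp only [hestenes2, hestenes, halfExt, Prod.swap_prod_mk, Prod.fst_swap, Prod.snd_swap]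
  ring

/-- The extension in `y` is linear, so it commutes with differencing in `x`. -/
theorem hestenes2_second_difference (F : ℝ × ℝ → ℝ) (x y h : ℝ) :
    hestenes2 F (x + h, y) - 2 * hestenes2 F (x, y) + hestenes2 F (x - h, y) =
      hestenes (fun t => hestenes (fun s => F (s, t)) (x + h)
        - 2 * hestenes (fun s => F (s, t)) x + hestenes (fun s => F (s, t)) (x - h)) y := by
  simp only [hestenes2]
  conv_rhs => simp only [hestenes, halfExt]
  conv_lhs => simp only [hestenes, halfExt]
  ring

theorem measurable_hestenes_left {F : ℝ × ℝ → ℝ} (hF : Measurable F) :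
    Measurable fun p : ℝ × ℝ => hestenes (fun x => F (x, p.2)) p.1 := by
  have h := continuous_cutoff.measurable
  simp only [hestenes, halfExt]
  fun_prop

theorem measurable_hestenes2 {F : ℝ × ℝ → ℝ} (hF : Measurable F) : Measurable (hestenes2 F) := by
  have h := measurable_hestenes_left (measurable_hestenes_left hF |>.comp measurable_swap)
  exact h.comp measurable_swap

namespace IsClampedX

variable {F p1 p2 q1 q2 : ℝ × ℝ → ℝ}

/-- Separate continuity suffices for joint measurability (Carathéodory functions); joint continuity
is not yet available. -/
theorem measurable (HX : IsClampedX F p1 p2) (HY : IsClampedX (fun p => F p.swap) q1 q2) :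
    Measurable F := by
  have h := measurable_uncurry_of_continuous_of_measurable (u := fun x y => F (x, y))
    (fun y => (HX.c2 y).cont) (fun x => (HY.c2 x).cont.measurable)
  exact h

theorem clamped_left_right (HY : IsClampedX (fun p => F p.swap) q1 q2) (x : ℝ) :
    (∀ y ≤ 0, F (x, y) = F (x, 0)) ∧ ∀ y, 1 ≤ y → F (x, y) = F (x, 1) :=
  ⟨(HY.c2 x).left, (HY.c2 x).right⟩

theorem exists_boundary_bound (HY : IsClampedX (fun p => F p.swap) q1 q2) (x : ℝ) :
    ∃ B : ℝ≥0, ∀ y, ‖F (x, y)‖ₑ ^ 2 ≤ B := by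
  obtain ⟨B, hB⟩ := isCompact_Icc.exists_bound_of_continuousOn
    (s := Icc (0 : ℝ) 1) (HY.c2 x).cont.continuousOn
  have hb : ∀ y, ‖F (x, y)‖ ≤ B := by
    intro y
    rcases le_total y 0 with h | h
    · rw [(clamped_left_right HY x).1 y h]; exact hB 0 (by simp)
    rcases le_total y 1 with h' | h'
    · exact hB y ⟨h, h'⟩
    · rw [(clamped_left_right HY x).2 y h']; exact hB 1 (by simp)
  refine ⟨(B ^ 2).toNNReal, fun y => ?_⟩
  rw [enorm_sq_eq_ofReal]
  refine ENNReal.ofReal_le_ofReal ?_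
  rw [← sq_abs]
  exact pow_le_pow_left₀ (abs_nonneg _) (hb y) 2

/-- The boundary values and the `L²` norm of the second derivative in the first variable. -/
theorem exists_energy (HX : IsClampedX F p1 p2) (HY : IsClampedX (fun p => F p.swap) q1 q2) :
    ∃ K : ℝ≥0, ∫⁻ y in Icc 0 1, (‖F (0, y)‖ₑ ^ 2 + ‖F (1, y)‖ₑ ^ 2 +
      ∫⁻ x, ‖p2 (x, y)‖ₑ ^ 2) ≤ K := by
  obtain ⟨B0, h0⟩ := exists_boundary_bound HY 0
  obtain ⟨B1, h1⟩ := exists_boundary_bound HY 1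
  refine ⟨(B0 + B1 + ∫⁻ y in Icc 0 1, ∫⁻ x, ‖p2 (x, y)‖ₑ ^ 2).toNNReal, ?_⟩
  rw [ENNReal.coe_toNNReal (by simp [HX.fin.ne])]
  refine (lintegral_mono fun y => add_le_add (add_le_add (h0 y) (h1 y)) le_rfl).trans ?_
  rw [lintegral_add_left measurable_const]
  simp

theorem ae_lintegral_lt_top (HX : IsClampedX F p1 p2) :
    ∀ᵐ y ∂volume.restrict (Icc (0 : ℝ) 1), ∫⁻ x, ‖p2 (x, y)‖ₑ ^ 2 < ∞ :=
  ae_lt_top' HX.meas HX.fin.ne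

theorem ae_enorm_sq_le (HX : IsClampedX F p1 p2) :
    ∀ᵐ y ∂volume.restrict (Icc (0 : ℝ) 1), ∀ x, ‖F (x, y)‖ₑ ^ 2 ≤
      12 * (‖F (0, y)‖ₑ ^ 2 + ‖F (1, y)‖ₑ ^ 2 + ∫⁻ x, ‖p2 (x, y)‖ₑ ^ 2) := by
  filter_upwards [HX.ae_lintegral_lt_top] with y hy x
  obtain ⟨M, hM, h1, -, h2⟩ := (HX.c2 y).exists_bound hy
  refine le_trans ?_ h2
  rw [enorm_sq_eq_ofReal]
  refine ENNReal.ofReal_le_ofReal ?_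
  rw [← sq_abs]
  exact pow_le_pow_left₀ (abs_nonneg _) (h1 x) 2

/-- An integrable function of one variable which dominates almost all sections. -/
theorem exists_majorant (HX : IsClampedX F p1 p2) (HY : IsClampedX (fun p => F p.swap) q1 q2) :
    ∃ N : ℝ → ℝ, IntegrableOn N (Icc 0 1) ∧
      ∀ᵐ y ∂volume.restrict (Icc (0 : ℝ) 1), ∀ x, |F (x, y)| ≤ N y := by
  obtain ⟨K, hK⟩ := exists_energy HX HY
  set E : ℝ → ℝ≥0∞ := fun y => ‖F (0, y)‖ₑ ^ 2 + ‖F (1, y)‖ₑ ^ 2 + ∫⁻ x, ‖p2 (x, y)‖ₑ ^ 2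
  have hEm : AEMeasurable E (volume.restrict (Icc (0 : ℝ) 1)) := by
    have m0 := (HY.c2 0).cont.measurable
    have m1 := (HY.c2 1).cont.measurable
    exact ((m0.enorm.pow_const 2).add (m1.enorm.pow_const 2)).aemeasurable.add HX.meas
  have hEf := ae_lt_top' hEm (hK.trans_lt ENNReal.coe_lt_top).ne
  -- The summand 1 passes from a bound on F² to one on |F|, by |t| ≤ 1 + t². Integrability of the
  -- majorant is what dominated convergence needs later.
  refine ⟨fun y => 1 + 12 * (E y).toReal, (integrable_const 1).add
    ((integrable_toReal_of_lintegral_ne_top hEm (hK.trans_lt ENNReal.coe_lt_top).ne).const_mul 12),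
    ?_⟩
  filter_upwards [hEf, HX.ae_enorm_sq_le] with y hy h x
  have h1 := h x
  rw [enorm_sq_eq_ofReal, ENNReal.ofReal_le_iff_le_toReal (ENNReal.mul_lt_top (by simp) hy).ne,
    ENNReal.toReal_mul] at h1
  have h2 : F (x, y) ^ 2 ≤ 12 * (E y).toReal := h1
  rw [← sq_abs] at h2
  nlinarith [sq_nonneg (|F (x, y)| - 1)]

theorem measurable_second_difference (hF : Measurable F) (h : ℝ) :
    Measurable fun p : ℝ × ℝ => hestenes (fun s => F (s, p.2)) (p.1 + h)
        - 2 * hestenes (fun s => F (s, p.2)) p.1 + hestenes (fun s => F (s, p.2)) (p.1 - h) := by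
  have m := measurable_hestenes_left hF
  have m1 := m.comp (show Measurable fun p : ℝ × ℝ => (p.1 + h, p.2) by fun_prop)
  have m2 := m.comp (show Measurable fun p : ℝ × ℝ => (p.1 - h, p.2) by fun_prop)
  exact (m1.sub (m.const_mul 2)).add m2

/-- The second difference in the first variable of the extension is of order `h²` in `L²`. -/
theorem exists_lintegral_second_difference_le (HX : IsClampedX F p1 p2)
    (HY : IsClampedX (fun p => F p.swap) q1 q2) :
    ∃ K : ℝ≥0, ∀ h : ℝ, 0 < h → ∫⁻ p : ℝ × ℝ, ‖hestenes2 F (p.1 + h, p.2) -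
      2 * hestenes2 F p + hestenes2 F (p.1 - h, p.2)‖ₑ ^ 2 ≤ ENNReal.ofReal (h ^ 4) * K := by
  obtain ⟨K, hK⟩ := exists_energy HX HY
  have hF := measurable HX HY
  refine ⟨90 * 10 ^ 9 * K, fun h hh => ?_⟩
  set U : ℝ × ℝ → ℝ := fun p => hestenes (fun s => F (s, p.2)) (p.1 + h)
        - 2 * hestenes (fun s => F (s, p.2)) p.1 + hestenes (fun s => F (s, p.2)) (p.1 - h) with hU
  have hUm : Measurable U := measurable_second_difference hF h
  have hUl : ∀ x, ∀ y ≤ 0, U (x, y) = U (x, 0) := fun x y hy => by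
    simp only [hU, fun s => (clamped_left_right HY s).1 y hy]
  have hUr : ∀ x, ∀ y, 1 ≤ y → U (x, y) = U (x, 1) := fun x y hy => by
    simp only [hU, fun s => (clamped_left_right HY s).2 y hy]
  have hD : ∀ p : ℝ × ℝ, hestenes2 F (p.1 + h, p.2) - 2 * hestenes2 F p +
      hestenes2 F (p.1 - h, p.2) = hestenes (fun t => U (p.1, t)) p.2 := fun p =>
    hestenes2_second_difference F p.1 p.2 h
  simp only [hD]
  have hm : Measurable fun p : ℝ × ℝ => hestenes (fun t => U (p.1, t)) p.2 :=
    (measurable_hestenes_left (hUm.comp measurable_swap)).comp measurable_swap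
  rw [Measure.volume_eq_prod, lintegral_prod _ (hm.enorm.pow_const 2).aemeasurable]
  -- The extension in `y` is bounded in L² by its values on 0 ≤ y ≤ 1. After exchanging the
  -- integrals, the one-variable estimate in `x` applies for almost every such `y`.
  calc ∫⁻ x, ∫⁻ y, ‖hestenes (fun t => U (x, t)) y‖ₑ ^ 2
      ≤ ∫⁻ x, 90 * ∫⁻ y in Icc 0 1, ‖U (x, y)‖ₑ ^ 2 :=
        lintegral_mono fun x => lintegral_hestenes_sq_le (by fun_prop) (hUl x) (hUr x)
    _ = 90 * ∫⁻ y in Icc 0 1, ∫⁻ x, ‖U (x, y)‖ₑ ^ 2 := by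
        rw [lintegral_const_mul' _ _ (by simp), lintegral_lintegral_swap (by fun_prop)]
    _ ≤ 90 * ∫⁻ y in Icc 0 1, ENNReal.ofReal (10 ^ 9 * h ^ 4) *
          (‖F (0, y)‖ₑ ^ 2 + ‖F (1, y)‖ₑ ^ 2 + ∫⁻ x, ‖p2 (x, y)‖ₑ ^ 2) := by
        refine mul_le_mul_right (lintegral_mono_ae ?_) _
        filter_upwards [HX.ae_lintegral_lt_top] with y hy
        exact (HX.c2 y).lintegral_hestenes_second_difference_le hy hh
    _ ≤ 90 * (ENNReal.ofReal (10 ^ 9 * h ^ 4) * K) := by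
        rw [lintegral_const_mul' _ _ ENNReal.ofReal_ne_top]
        gcongr
    _ = _ := by
        rw [ENNReal.ofReal_mul (by norm_num)]
        push_cast
        norm_num
        ring

theorem lintegral_hestenes2_sq_lt_top (HX : IsClampedX F p1 p2)
    (HY : IsClampedX (fun p => F p.swap) q1 q2) :
    ∫⁻ p : ℝ × ℝ, ‖hestenes2 F p‖ₑ ^ 2 < ∞ := by
  obtain ⟨K, hK⟩ := exists_energy HX HY
  have hF := measurable HX HY
  have hm := measurable_hestenes2 hF
  have hl := measurable_hestenes_left hF
  rw [Measure.volume_eq_prod, lintegral_prod _ (by fun_prop)]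
  have hL : ∀ x, ∀ y ≤ 0, hestenes (fun s => F (s, y)) x = hestenes (fun s => F (s, 0)) x :=
    fun x y hy => by simp only [fun s => (clamped_left_right HY s).1 y hy]
  have hR : ∀ x, ∀ y, 1 ≤ y → hestenes (fun s => F (s, y)) x = hestenes (fun s => F (s, 1)) x :=
    fun x y hy => by simp only [fun s => (clamped_left_right HY s).2 y hy]
  calc ∫⁻ x, ∫⁻ y, ‖hestenes2 F (x, y)‖ₑ ^ 2
      ≤ ∫⁻ x, 90 * ∫⁻ y in Icc 0 1, ‖hestenes (fun s => F (s, y)) x‖ₑ ^ 2 :=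
        lintegral_mono fun x => lintegral_hestenes_sq_le
          (hl.comp (measurable_const.prodMk measurable_id)) (hL x) (hR x)
    _ = 90 * ∫⁻ y in Icc 0 1, ∫⁻ x, ‖hestenes (fun s => F (s, y)) x‖ₑ ^ 2 := by
        rw [lintegral_const_mul' _ _ (by simp),
          lintegral_lintegral_swap (hl.enorm.pow_const 2).aemeasurable]
    _ ≤ 90 * ∫⁻ y in Icc 0 1, 90 * ∫⁻ x in Icc 0 1, ‖F (x, y)‖ₑ ^ 2 := by
        gcongr with y
        exact lintegral_hestenes_sq_le (HX.c2 y).cont.measurable (HX.c2 y).left (HX.c2 y).right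
    _ ≤ 90 * ∫⁻ y in Icc 0 1, 90 * (12 * (‖F (0, y)‖ₑ ^ 2 + ‖F (1, y)‖ₑ ^ 2 +
          ∫⁻ x, ‖p2 (x, y)‖ₑ ^ 2)) := by
        refine mul_le_mul_right (lintegral_mono_ae ?_) _
        filter_upwards [HX.ae_enorm_sq_le] with y hy
        refine mul_le_mul_right ((lintegral_mono hy).trans ?_) _
        simp
    _ ≤ 90 * (90 * (12 * K)) := by
        rw [lintegral_const_mul' _ _ (by simp), lintegral_const_mul' _ _ (by simp)]
        gcongr
    _ < ∞ := by
        exact ENNReal.mul_lt_top (by simp) (ENNReal.mul_lt_top (by simp)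
          (ENNReal.mul_lt_top (by simp) ENNReal.coe_lt_top))

theorem hestenes2_of_mem (HX : IsClampedX F p1 p2) (HY : IsClampedX (fun p => F p.swap) q1 q2)
    {x y : ℝ} (hx : x ∈ Icc (0 : ℝ) 1) (hy : y ∈ Icc (0 : ℝ) 1) :
    hestenes2 F (x, y) = F (x, y) := by
  have h : ∀ t, hestenes (fun s => F (s, t)) x = F (x, t) := fun t =>
    hestenes_of_mem (HX.c2 t).left (HX.c2 t).right hx
  simp only [hestenes2, h]
  exact hestenes_of_mem (clamped_left_right HY x).1 (clamped_left_right HY x).2 hy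

end IsClampedX

/-! ### Summation by parts and the L² bound for mixed differences. -/

theorem memLp_two_iff_lintegral {α : Type*} [MeasurableSpace α] {μ : Measure α} {u : α → ℝ}
    (hu : AEStronglyMeasurable u μ) : MemLp u 2 μ ↔ ∫⁻ x, ‖u x‖ₑ ^ 2 ∂μ < ∞ := by
  rw [MemLp, and_iff_right hu, eLpNorm_lt_top_iff_lintegral_rpow_enorm_lt_top (by norm_num)
    (by norm_num)]
  norm_num

theorem MeasureTheory.MemLp.comp_add_right_prod {u : ℝ × ℝ → ℝ} (hu : MemLp u 2) (a : ℝ × ℝ) :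
    MemLp (fun p => u (p + a)) 2 :=
  hu.comp_measurePreserving (measurePreserving_add_right volume a)

theorem MeasureTheory.MemLp.comp_sub_right_prod {u : ℝ × ℝ → ℝ} (hu : MemLp u 2) (a : ℝ × ℝ) :
    MemLp (fun p => u (p - a)) 2 := by
  simpa [sub_eq_add_neg] using hu.comp_add_right_prod (-a)

/-- Summation by parts for difference operators in `L²` of the plane. -/
theorem integral_diff_mul {u v : ℝ × ℝ → ℝ} (hu : MemLp u 2) (hv : MemLp v 2) (a : ℝ × ℝ) :
    ∫ p, (u (p + a) - u p) * v p = ∫ p, u p * (v (p - a) - v p) := by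
  have h1 : ∫ p, u (p + a) * v p = ∫ p, u p * v (p - a) := by
    rw [← integral_add_right_eq_self (fun p => u p * v (p - a)) a]
    simp
  have i1 : Integrable fun p => u (p + a) * v p := (hu.comp_add_right_prod a).integrable_mul hv
  have i2 : Integrable fun p => u p * v p := hu.integrable_mul hv
  have i3 : Integrable fun p => u p * v (p - a) := hu.integrable_mul (hv.comp_sub_right_prod a)
  simp only [sub_mul, mul_sub]
  rw [integral_sub i1 i2, integral_sub i3 i2, h1]

/-- The `L²` norm of a mixed difference expressed by the pure second differences. -/
theorem integral_mixed_difference_sq {w : ℝ × ℝ → ℝ} (hw : MemLp w 2) (a b : ℝ × ℝ) :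
    ∫ p, (w (p + a + b) - w (p + a) - (w (p + b) - w p)) ^ 2 =
      ∫ p, (w (p + a) - 2 * w p + w (p - a)) * (w (p + b) - 2 * w p + w (p - b)) := by
  have hb : MemLp (fun p => w (p + b) - w p) 2 := (hw.comp_add_right_prod b).sub hw
  have hz : MemLp (fun p => (w (p + a + b) - w (p + a) - (w (p + b) - w p))) 2 :=
    (hb.comp_add_right_prod a).sub hb
  have hω : MemLp (fun p => 2 * w p - w (p - a) - w (p + a)) 2 :=
    ((hw.const_mul 2).sub (hw.comp_sub_right_prod a)).sub (hw.comp_add_right_prod a)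
  -- Moving a difference Δ_c to the other factor turns it into Δ_{-c}, and Δ_{-c}Δ_c is minus the
  -- centred second difference. Doing this for `a` and then for `b` makes the two signs cancel.
  have s1 := integral_diff_mul hb hz a
  have s2 := integral_diff_mul hω hb b
  calc _ = ∫ p, (w (p + a + b) - w (p + a) - (w (p + b) - w p)) *
        (w (p + a + b) - w (p + a) - (w (p + b) - w p)) := by simp only [sq]
    _ = _ := s1
    _ = ∫ p, (2 * w (p + b) - w (p + b - a) - w (p + b + a) -
        (2 * w p - w (p - a) - w (p + a))) * (w (p + b) - w p) := by
        congr 1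
        ext p
        rw [show p - a + a = p by abel, show p - a + b = p + b - a by abel,
          show p + a + b = p + b + a by abel]
        ring
    _ = _ := s2
    _ = _ := by
        congr 1
        ext p
        rw [show p - b + b = p by abel]
        ring

theorem ofReal_integral_sq {α : Type*} [MeasurableSpace α] {μ : Measure α} {u : α → ℝ}
    (hu : MemLp u 2 μ) : ENNReal.ofReal (∫ x, u x ^ 2 ∂μ) = ∫⁻ x, ‖u x‖ₑ ^ 2 ∂μ := by
  rw [ofReal_integral_eq_lintegral_ofReal hu.integrable_sq
    (Eventually.of_forall fun x => sq_nonneg _)]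
  simp only [enorm_sq_eq_ofReal]

theorem lintegral_mixed_difference_le {w : ℝ × ℝ → ℝ} (hw : MemLp w 2) {K : ℝ≥0}
    (h1 : ∀ h : ℝ, 0 < h → ∫⁻ p : ℝ × ℝ, ‖w (p + (h, 0)) - 2 * w p + w (p - (h, 0))‖ₑ ^ 2 ≤
      ENNReal.ofReal (h ^ 4) * K)
    (h2 : ∀ h : ℝ, 0 < h → ∫⁻ p : ℝ × ℝ, ‖w (p + (0, h)) - 2 * w p + w (p - (0, h))‖ₑ ^ 2 ≤
      ENNReal.ofReal (h ^ 4) * K) {h k : ℝ} (hh : 0 < h) (hk : 0 < k) :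
    ∫⁻ p : ℝ × ℝ, ‖(h * k)⁻¹ * (w (p + (h, 0) + (0, k)) - w (p + (h, 0)) -
      (w (p + (0, k)) - w p))‖ₑ ^ 2 ≤ K := by
  set a : ℝ × ℝ := (h, 0)
  set b : ℝ × ℝ := (0, k)
  have hD : ∀ c : ℝ × ℝ, MemLp (fun p => w (p + c) - 2 * w p + w (p - c)) 2 := fun c =>
    ((hw.comp_add_right_prod c).sub (hw.const_mul 2)).add (hw.comp_sub_right_prod c)
  have hb : MemLp (fun p => w (p + b) - w p) 2 := (hw.comp_add_right_prod b).sub hw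
  have hz : MemLp (fun p => (w (p + a + b) - w (p + a) - (w (p + b) - w p))) 2 :=
    (hb.comp_add_right_prod a).sub hb
  have r1 : ∫ p, (w (p + a) - 2 * w p + w (p - a)) ^ 2 ≤ h ^ 4 * K := by
    have := h1 h hh
    rw [← ofReal_integral_sq (hD a), ← ENNReal.ofReal_coe_nnreal,
      ← ENNReal.ofReal_mul (by positivity)] at this
    exact (ENNReal.ofReal_le_ofReal_iff (by positivity)).1 this
  have r2 : ∫ p, (w (p + b) - 2 * w p + w (p - b)) ^ 2 ≤ k ^ 4 * K := by
    have := h2 k hk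
    rw [← ofReal_integral_sq (hD b), ← ENNReal.ofReal_coe_nnreal,
      ← ENNReal.ofReal_mul (by positivity)] at this
    exact (ENNReal.ofReal_le_ofReal_iff (by positivity)).1 this
  rw [← ofReal_integral_sq (hz.const_mul _), ← ENNReal.ofReal_coe_nnreal]
  refine ENNReal.ofReal_le_ofReal ?_
  simp only [mul_pow]
  rw [integral_const_mul, integral_mixed_difference_sq hw]
  -- The weights in the inequality between the product and the squares balance the bounds h⁴K and
  -- k⁴K, so that each half contributes h²k²K/2.
  have r3 : ∫ p, (w (p + a) - 2 * w p + w (p - a)) * (w (p + b) - 2 * w p + w (p - b)) ≤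
      ∫ p, (k ^ 2 / (2 * h ^ 2) * (w (p + a) - 2 * w p + w (p - a)) ^ 2 +
        h ^ 2 / (2 * k ^ 2) * (w (p + b) - 2 * w p + w (p - b)) ^ 2) := by
    refine integral_mono ((hD a).integrable_mul (hD b))
      (((hD a).integrable_sq.const_mul _).add ((hD b).integrable_sq.const_mul _)) fun p => ?_
    simp only
    set A := w (p + a) - 2 * w p + w (p - a)
    set B := w (p + b) - 2 * w p + w (p - b)
    have : k ^ 2 / (2 * h ^ 2) * A ^ 2 + h ^ 2 / (2 * k ^ 2) * B ^ 2 - A * B =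
        (k / h * A - h / k * B) ^ 2 / 2 := by field_simp; ring
    nlinarith [sq_nonneg (k / h * A - h / k * B)]
  rw [integral_add ((hD a).integrable_sq.const_mul _) ((hD b).integrable_sq.const_mul _),
    integral_const_mul, integral_const_mul] at r3
  have r4 : k ^ 2 / (2 * h ^ 2) * (h ^ 4 * K) + h ^ 2 / (2 * k ^ 2) * (k ^ 4 * K) =
      (h * k) ^ 2 * K := by field_simp; ring
  have r5 := r3.trans (add_le_add (mul_le_mul_of_nonneg_left r1 (by positivity))
    (mul_le_mul_of_nonneg_left r2 (by positivity)))
  rw [r4] at r5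
  calc _ ≤ ((h * k)⁻¹) ^ 2 * ((h * k) ^ 2 * (K : ℝ)) := by gcongr
    _ = K := by field_simp

/-! ### Weak limits in L². -/

/-- Weak compactness of balls in a Hilbert space. -/
theorem exists_weak_limit {H ι : Type*} [NormedAddCommGroup H] [InnerProductSpace ℝ H]
    [CompleteSpace H] (l : Filter ι) [l.NeBot] {v : ι → H} {C : ℝ} (hv : ∀ᶠ i in l, ‖v i‖ ≤ C) :
    ∃ g : H, ∀ (φ : H) (c : ℝ), Tendsto (fun i => inner ℝ (v i) φ) l (𝓝 c) → inner ℝ g φ = c := by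
  -- By Banach–Alaoglu the functionals converge weak-* along an ultrafilter finer than `l`. A
  -- pairing that already converges along `l` must have the same limit, so neither sequences nor
  -- separability are needed.
  let U : Ultrafilter ι := Ultrafilter.of l
  have hU : (U : Filter ι) ≤ l := Ultrafilter.of_le l
  let T : ι → WeakDual ℝ H := fun i => StrongDual.toWeakDual (InnerProductSpace.toDual ℝ H (v i))
  have hc := WeakDual.isCompact_closedBall (𝕜 := ℝ) (0 : StrongDual ℝ H) C
  obtain ⟨L, -, hL⟩ := hc.ultrafilter_le_nhds (U.map T) (by
    rw [le_principal_iff]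
    have : ∀ᶠ i in (U : Filter ι), T i ∈ WeakDual.toStrongDual ⁻¹'
        Metric.closedBall (0 : StrongDual ℝ H) C := by
      filter_upwards [hv.filter_mono hU] with i hi
      simpa [T] using hi
    exact this)
  refine ⟨(InnerProductSpace.toDual ℝ H).symm (WeakDual.toStrongDual L), fun φ c hφ => ?_⟩
  have h1 : Tendsto (fun i => T i φ) U (𝓝 (L φ)) :=
    ((WeakDual.eval_continuous φ).tendsto L).comp hL
  rw [InnerProductSpace.toDual_symm_apply]
  exact tendsto_nhds_unique h1 (hφ.mono_left hU)

theorem exists_weak_limit_memLp {α ι : Type*} [MeasurableSpace α] {μ : Measure α} (l : Filter ι)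
    [l.NeBot] {v : ι → α → ℝ} {C : ℝ≥0} (hm : ∀ i, MemLp (v i) 2 μ)
    (hv : ∀ᶠ i in l, ∫⁻ x, ‖v i x‖ₑ ^ 2 ∂μ ≤ C) :
    ∃ g : α → ℝ, MemLp g 2 μ ∧ ∀ (φ : α → ℝ) (c : ℝ), MemLp φ 2 μ →
      Tendsto (fun i => ∫ x, v i x * φ x ∂μ) l (𝓝 c) → ∫ x, g x * φ x ∂μ = c := by
  have hin : ∀ (u φ : α → ℝ) (hu : MemLp u 2 μ) (hφ : MemLp φ 2 μ),
      inner ℝ hu.toLp hφ.toLp = ∫ x, u x * φ x ∂μ := by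
    intro u φ hu hφ
    rw [L2.inner_def]
    refine integral_congr_ae ?_
    filter_upwards [hu.coeFn_toLp, hφ.coeFn_toLp] with x h1 h2
    rw [h1, h2]
    simp [mul_comm]
  obtain ⟨g, hg⟩ := exists_weak_limit l (v := fun i => (hm i).toLp) (C := Real.sqrt C) (by
    filter_upwards [hv] with i hi
    rw [Real.le_sqrt (norm_nonneg _) (by positivity), ← real_inner_self_eq_norm_sq, hin]
    rw [← ofReal_integral_sq (hm i), ← ENNReal.ofReal_coe_nnreal,
      ENNReal.ofReal_le_ofReal_iff (by positivity)] at hi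
    simpa only [sq] using hi)
  refine ⟨g, Lp.memLp g, fun φ c hφ hc => ?_⟩
  rw [← hg hφ.toLp c (by simpa only [hin] using hc), ← hin g φ (Lp.memLp g) hφ, Lp.toLp_coeFn]

/-! ### Integrals of the mixed quotients over rectangles. -/

theorem tendsto_average_right {u : ℝ → ℝ} (hu : Continuous u) (b : ℝ) :
    Tendsto (fun k => k⁻¹ * ∫ y in b..b + k, u y) (𝓝[>] 0) (𝓝 (u b)) := by
  have h := (intervalIntegral.integral_hasDerivAt_right (hu.intervalIntegrable b b)
    hu.aestronglyMeasurable.stronglyMeasurableAtFilter hu.continuousAt).tendsto_slope_zero_right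
  simpa using h

theorem integral_shift_sub {u : ℝ → ℝ} {b k : ℝ} (hb : 0 ≤ b) (hk : 0 ≤ k)
    (hu : IntervalIntegrable u volume 0 (b + k)) :
    ∫ y in (0 : ℝ)..b, (u (y + k) - u y) = (∫ y in b..b + k, u y) - ∫ y in (0 : ℝ)..k, u y := by
  have hsub : ∀ {c d : ℝ}, c ∈ Icc 0 (b + k) → d ∈ Icc 0 (b + k) → IntervalIntegrable u volume c d :=
    fun hc hd => hu.mono_set (by
      rw [uIcc_of_le (by linarith : 0 ≤ b + k)]
      exact uIcc_subset_Icc hc hd)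
  have m0 : (0 : ℝ) ∈ Icc 0 (b + k) := ⟨le_rfl, by linarith⟩
  have mb : b ∈ Icc 0 (b + k) := ⟨hb, by linarith⟩
  have mk : k ∈ Icc 0 (b + k) := ⟨hk, by linarith⟩
  have mbk : b + k ∈ Icc 0 (b + k) := ⟨by linarith, le_rfl⟩
  have i1 : IntervalIntegrable (fun y => u (y + k)) volume 0 b := by
    have := (hsub mk mbk).comp_add_right k
    simpa using this
  rw [intervalIntegral.integral_sub i1 (hsub m0 mb), intervalIntegral.integral_comp_add_right u k,
    zero_add]
  have e1 := intervalIntegral.integral_add_adjacent_intervals (hsub m0 mk) (hsub mk mbk)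
  have e2 := intervalIntegral.integral_add_adjacent_intervals (hsub m0 mb) (hsub mb mbk)
  linarith

/-- The difference of the averages of `F (x, ·)` over `[b, b + k]` and over `[0, k]`. -/
noncomputable def stripAverage (F : ℝ × ℝ → ℝ) (b k x : ℝ) : ℝ :=
  k⁻¹ * ((∫ y in b..b + k, F (x, y)) - ∫ y in (0 : ℝ)..k, F (x, y))

theorem tendsto_stripAverage {F : ℝ × ℝ → ℝ} {x : ℝ} (hF : Continuous fun y => F (x, y)) (b : ℝ) :
    Tendsto (fun k => stripAverage F b k x) (𝓝[>] 0) (𝓝 (F (x, b) - F (x, 0))) := by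
  have h := (tendsto_average_right hF b).sub (tendsto_average_right hF 0)
  simp only [← mul_sub, zero_add] at h
  exact h

theorem measurable_stripAverage {F : ℝ × ℝ → ℝ} (hF : Measurable F) (b k : ℝ) :
    Measurable (stripAverage F b k) := by
  have h : ∀ c d : ℝ, Measurable fun x => ∫ y in c..d, F (x, y) := fun c d => by
    simp only [intervalIntegral]
    exact (hF.stronglyMeasurable.integral_prod_right'.measurable).sub
      (hF.stronglyMeasurable.integral_prod_right'.measurable)
  exact ((h _ _).sub (h _ _)).const_mul _

theorem abs_stripAverage_le {F : ℝ × ℝ → ℝ} {x N b k : ℝ} (hk : 0 < k)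
    (hN : ∀ y, |F (x, y)| ≤ N) : |stripAverage F b k x| ≤ 2 * N := by
  have h : ∀ c, |∫ y in c..c + k, F (x, y)| ≤ N * k := fun c => by
    have := intervalIntegral.norm_integral_le_of_norm_le_const (a := c) (b := c + k)
      (f := fun y => F (x, y)) (C := N) (fun y _ => hN y)
    simpa [abs_of_pos hk] using this
  have h1 := h b
  have h2 := h 0
  rw [zero_add] at h2
  rw [stripAverage, abs_mul, abs_inv, abs_of_pos hk, inv_mul_le_iff₀ hk]
  refine (abs_sub _ _).trans ?_
  linarith

/-- The difference quotient of the mixed derivative. -/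
noncomputable def mixedQuotient (w : ℝ × ℝ → ℝ) (i p : ℝ × ℝ) : ℝ :=
  (i.1 * i.2)⁻¹ * (w (p + (i.1, 0) + (0, i.2)) - w (p + (i.1, 0)) - (w (p + (0, i.2)) - w p))

theorem memLp_mixedQuotient {w : ℝ × ℝ → ℝ} (hw : MemLp w 2) (i : ℝ × ℝ) :
    MemLp (mixedQuotient w i) 2 := by
  have hb : MemLp (fun p => w (p + (0, i.2)) - w p) 2 := (hw.comp_add_right_prod _).sub hw
  exact ((hb.comp_add_right_prod (i.1, 0)).sub hb).const_mul _

namespace IsClampedX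

variable {F p1 p2 q1 q2 : ℝ × ℝ → ℝ}

/-- Integrating a difference quotient telescopes to averages near the ends of the interval, here in
both variables. The conditions `a + h ≤ 1` and `b + k ≤ 1` keep all four corners in the square,
where the extension agrees with `F`. -/
theorem setIntegral_mixedQuotient (HX : IsClampedX F p1 p2)
    (HY : IsClampedX (fun p => F p.swap) q1 q2) (hw : MemLp (hestenes2 F) 2)
    {a b h k : ℝ} (ha : 0 ≤ a) (hb : 0 ≤ b) (hh : 0 < h) (hk : 0 < k) (hah : a + h ≤ 1)
    (hbk : b + k ≤ 1) (hint : IntervalIntegrable (stripAverage F b k) volume 0 (a + h)) :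
    ∫ p in Ioc 0 a ×ˢ Ioc 0 b, mixedQuotient (hestenes2 F) (h, k) p =
      h⁻¹ * ((∫ x in a..a + h, stripAverage F b k x) - ∫ x in (0 : ℝ)..h, stripAverage F b k x) := by
  have hV := memLp_mixedQuotient hw (h, k)
  have hVi : IntegrableOn (mixedQuotient (hestenes2 F) (h, k)) (Ioc 0 a ×ˢ Ioc 0 b) := by
    have : IsFiniteMeasure (volume.restrict (Ioc 0 a ×ˢ Ioc 0 b) : Measure (ℝ × ℝ)) := by
      refine ⟨?_⟩
      rw [Measure.restrict_apply_univ, Measure.volume_eq_prod, Measure.prod_prod]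
      exact ENNReal.mul_lt_top (by simp) (by simp)
    exact (hV.restrict _).integrable one_le_two
  rw [Measure.volume_eq_prod] at hVi ⊢
  rw [setIntegral_prod _ hVi, ← integral_shift_sub ha hh.le hint,
    intervalIntegral.integral_of_le ha, ← integral_const_mul]
  refine setIntegral_congr_fun measurableSet_Ioc fun x hx => ?_
  have hc : ∀ x, Continuous fun y => F (x, y) := fun x => (HY.c2 x).cont
  have hi : ∀ x, IntervalIntegrable (fun y => F (x, y + k) - F (x, y)) volume 0 b := fun x =>
    (((hc x).comp (continuous_add_const k)).sub (hc x)).intervalIntegrable _ _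
  rw [stripAverage, stripAverage, ← integral_shift_sub hb hk.le ((hc _).intervalIntegrable _ _),
    ← integral_shift_sub hb hk.le ((hc _).intervalIntegrable _ _), ← mul_sub,
    ← intervalIntegral.integral_sub
      (hi (x + h))
      (hi x),
    intervalIntegral.integral_of_le hb, ← integral_const_mul, ← integral_const_mul]
  refine setIntegral_congr_fun measurableSet_Ioc fun y hy => ?_
  have x1 : x ∈ Icc (0 : ℝ) 1 := ⟨hx.1.le, by linarith [hx.2]⟩
  have x2 : x + h ∈ Icc (0 : ℝ) 1 := ⟨by linarith [hx.1], by linarith [hx.2]⟩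
  have y1 : y ∈ Icc (0 : ℝ) 1 := ⟨hy.1.le, by linarith [hy.2]⟩
  have y2 : y + k ∈ Icc (0 : ℝ) 1 := ⟨by linarith [hy.1], by linarith [hy.2]⟩
  simp only [mixedQuotient, Prod.mk_add_mk, add_zero, hestenes2_of_mem HX HY x1 y1,
    hestenes2_of_mem HX HY x1 y2, hestenes2_of_mem HX HY x2 y1, hestenes2_of_mem HX HY x2 y2,
    mul_inv]
  ring

/-- The limit is iterated: k → 0 for fixed h by dominated convergence, then h → 0 by continuity of
the sections. The curried filter expresses this order and avoids a joint limit, which would call for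
joint continuity. -/
theorem tendsto_setIntegral_mixedQuotient (HX : IsClampedX F p1 p2)
    (HY : IsClampedX (fun p => F p.swap) q1 q2) (hw : MemLp (hestenes2 F) 2) {a b : ℝ}
    (ha : 0 ≤ a) (ha1 : a < 1) (hb : 0 ≤ b) (hb1 : b < 1) :
    Tendsto (fun i => ∫ p in Ioc 0 a ×ˢ Ioc 0 b, mixedQuotient (hestenes2 F) i p)
      ((𝓝[>] (0 : ℝ)).curry (𝓝[>] (0 : ℝ)))
      (𝓝 (F (a, b) - F (a, 0) - (F (0, b) - F (0, 0)))) := by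
  obtain ⟨N, hNi, hN⟩ := exists_majorant (F := fun p => F p.swap) HY HX
  have hN' : ∀ᵐ x, x ∈ Icc (0 : ℝ) 1 → ∀ y, |F (x, y)| ≤ N x :=
    (ae_restrict_iff' measurableSet_Icc).1 hN
  have hF := measurable HX HY
  have hdom : ∀ c d : ℝ, c ∈ Icc (0 : ℝ) 1 → d ∈ Icc (0 : ℝ) 1 →
      IntervalIntegrable (fun x => 2 * N x) volume c d := fun c d hc hd =>
    (IntegrableOn.mono_set (hNi.const_mul 2) (uIcc_subset_Icc hc hd)).intervalIntegrable
  have hbd : ∀ c d : ℝ, c ∈ Icc (0 : ℝ) 1 → d ∈ Icc (0 : ℝ) 1 → ∀ k, 0 < k →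
      ∀ᵐ x, x ∈ uIoc c d → ‖stripAverage F b k x‖ ≤ 2 * N x := by
    intro c d hc hd k hk
    filter_upwards [hN'] with x hx hxm
    exact abs_stripAverage_le hk (hx ((uIcc_subset_Icc hc hd) (uIoc_subset_uIcc hxm)))
  have hφ : Continuous fun x => F (x, b) - F (x, 0) := (HX.c2 b).cont.sub (HX.c2 0).cont
  have houter : Tendsto (fun h => h⁻¹ * ((∫ x in a..a + h, (F (x, b) - F (x, 0))) -
      ∫ x in (0 : ℝ)..h, (F (x, b) - F (x, 0)))) (𝓝[>] 0)
      (𝓝 (F (a, b) - F (a, 0) - (F (0, b) - F (0, 0)))) := by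
    have := (tendsto_average_right hφ a).sub (tendsto_average_right hφ 0)
    simp only [← mul_sub, zero_add] at this
    exact this
  have hinner : ∀ h, 0 < h → a + h ≤ 1 → Tendsto (fun k =>
      ∫ p in Ioc 0 a ×ˢ Ioc 0 b, mixedQuotient (hestenes2 F) (h, k) p) (𝓝[>] 0)
      (𝓝 (h⁻¹ * ((∫ x in a..a + h, (F (x, b) - F (x, 0))) -
      ∫ x in (0 : ℝ)..h, (F (x, b) - F (x, 0))))) := by
    intro h hh hah
    have hlim : ∀ c d : ℝ, c ∈ Icc (0 : ℝ) 1 → d ∈ Icc (0 : ℝ) 1 →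
        Tendsto (fun k => ∫ x in c..d, stripAverage F b k x) (𝓝[>] 0)
          (𝓝 (∫ x in c..d, (F (x, b) - F (x, 0)))) := by
      intro c d hc hd
      refine intervalIntegral.tendsto_integral_filter_of_dominated_convergence (fun x => 2 * N x)
        (Eventually.of_forall fun k => (measurable_stripAverage hF b k).aestronglyMeasurable)
        ?_ (hdom c d hc hd)
        (Eventually.of_forall fun x _ => tendsto_stripAverage (HY.c2 x).cont b)
      filter_upwards [self_mem_nhdsWithin] with k hk
      exact hbd c d hc hd k hk
    have m0 : (0 : ℝ) ∈ Icc (0 : ℝ) 1 := by simp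
    have ma : a ∈ Icc (0 : ℝ) 1 := ⟨ha, ha1.le⟩
    have mh : h ∈ Icc (0 : ℝ) 1 := ⟨hh.le, by linarith⟩
    have mah : a + h ∈ Icc (0 : ℝ) 1 := ⟨by linarith, hah⟩
    refine (((hlim a (a + h) ma mah).sub (hlim 0 h m0 mh)).const_mul h⁻¹).congr' ?_
    have hk1 : ∀ᶠ k in 𝓝[>] (0 : ℝ), k < 1 - b :=
      (eventually_lt_nhds (by linarith)).filter_mono nhdsWithin_le_nhds
    filter_upwards [self_mem_nhdsWithin, hk1] with k hk hk1
    rw [setIntegral_mixedQuotient HX HY hw ha hb hh hk hah (by linarith)]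
    refine (hdom 0 (a + h) m0 mah).mono_fun
      (measurable_stripAverage hF b k).aestronglyMeasurable ?_
    have := hbd 0 (a + h) m0 mah k hk
    rw [EventuallyLE, ae_restrict_iff' measurableSet_uIoc]
    filter_upwards [this] with x hx hxm
    exact (hx hxm).trans (le_abs_self _)
  rw [tendsto_nhds]
  intro s hs hmem
  change ∀ᶠ i in (𝓝[>] (0 : ℝ)).curry (𝓝[>] (0 : ℝ)), _ ∈ s
  rw [eventually_curry_iff]
  have hh1 : ∀ᶠ h in 𝓝[>] (0 : ℝ), h < 1 - a :=
    (eventually_lt_nhds (by linarith)).filter_mono nhdsWithin_le_nhds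
  filter_upwards [houter (hs.mem_nhds hmem), self_mem_nhdsWithin, hh1] with h h1 h2 h3
  exact hinner h h2 (by linarith) (hs.mem_nhds h1)

/-- The mixed quotients are bounded in L². Testing a weak limit point against the indicator of a
rectangle identifies its integral, because those pairings converge. -/
theorem exists_weak_mixed_derivative_of_lt (HX : IsClampedX F p1 p2)
    (HY : IsClampedX (fun p => F p.swap) q1 q2) :
    ∃ g : ℝ × ℝ → ℝ, MemLp g 2 ∧ ∀ a b : ℝ, 0 ≤ a → a < 1 → 0 ≤ b → b < 1 →
      ∫ p in Ioc 0 a ×ˢ Ioc 0 b, g p = F (a, b) - F (a, 0) - (F (0, b) - F (0, 0)) := by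
  have hw : MemLp (hestenes2 F) 2 := (memLp_two_iff_lintegral
    (measurable_hestenes2 (measurable HX HY)).aestronglyMeasurable).2
    (lintegral_hestenes2_sq_lt_top HX HY)
  obtain ⟨K1, hK1⟩ := exists_lintegral_second_difference_le HX HY
  obtain ⟨K2, hK2⟩ := exists_lintegral_second_difference_le (F := fun p => F p.swap) HY HX
  have e1 : ∀ h : ℝ, 0 < h → ∫⁻ p : ℝ × ℝ, ‖hestenes2 F (p + (h, 0)) - 2 * hestenes2 F p +
      hestenes2 F (p - (h, 0))‖ₑ ^ 2 ≤ ENNReal.ofReal (h ^ 4) * (max K1 K2 : ℝ≥0) := by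
    intro h hh
    refine le_trans (le_of_eq ?_) ((hK1 h hh).trans (by gcongr; exact le_max_left _ _))
    congr 1
    ext p
    simp [Prod.add_def, Prod.sub_def]
  have e2 : ∀ h : ℝ, 0 < h → ∫⁻ p : ℝ × ℝ, ‖hestenes2 F (p + (0, h)) - 2 * hestenes2 F p +
      hestenes2 F (p - (0, h))‖ₑ ^ 2 ≤ ENNReal.ofReal (h ^ 4) * (max K1 K2 : ℝ≥0) := by
    intro h hh
    refine le_trans (le_of_eq ?_) ((hK2 h hh).trans (by gcongr; exact le_max_right _ _))
    rw [Measure.volume_eq_prod]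
    refine Eq.trans ?_ (lintegral_prod_swap _)
    congr 1
    ext p
    rw [← hestenes2_swap F (p + (0, h)), ← hestenes2_swap F p, ← hestenes2_swap F (p - (0, h))]
    simp [Prod.add_def, Prod.sub_def, Prod.swap]
  have : ((𝓝[>] (0 : ℝ)).curry (𝓝[>] (0 : ℝ))).NeBot := by
    refine ⟨fun h => ?_⟩
    have hf : ∀ᶠ _ in (𝓝[>] (0 : ℝ)).curry (𝓝[>] (0 : ℝ)), False := by rw [h]; trivial
    rw [eventually_curry_iff] at hf
    simp only [eventually_const] at hf
  obtain ⟨g, hg, hlim⟩ := exists_weak_limit_memLp ((𝓝[>] (0 : ℝ)).curry (𝓝[>] (0 : ℝ)))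
    (v := mixedQuotient (hestenes2 F)) (C := max K1 K2) (memLp_mixedQuotient hw) (by
      rw [eventually_curry_iff]
      filter_upwards [self_mem_nhdsWithin] with h hh
      filter_upwards [self_mem_nhdsWithin] with k hk
      exact lintegral_mixed_difference_le hw e1 e2 hh hk)
  refine ⟨g, hg, fun a b ha ha1 hb hb1 => ?_⟩
  have hR : MeasurableSet (Ioc 0 a ×ˢ Ioc 0 b) := measurableSet_Ioc.prod measurableSet_Ioc
  have hφ : MemLp ((Ioc 0 a ×ˢ Ioc 0 b).indicator fun _ : ℝ × ℝ => (1 : ℝ)) 2 :=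
    memLp_indicator_const _ hR _ (Or.inr (by
      rw [Measure.volume_eq_prod, Measure.prod_prod]
      exact (ENNReal.mul_lt_top (by simp) (by simp)).ne))
  have hmul : ∀ u : ℝ × ℝ → ℝ, ∫ p, u p * (Ioc 0 a ×ˢ Ioc 0 b).indicator (fun _ => (1 : ℝ)) p =
      ∫ p in Ioc 0 a ×ˢ Ioc 0 b, u p := fun u => by
    rw [← integral_indicator hR]
    congr 1
    ext p
    by_cases hp : p ∈ Ioc 0 a ×ˢ Ioc 0 b <;> simp [hp]
  have := hlim _ (F (a, b) - F (a, 0) - (F (0, b) - F (0, 0))) hφ (by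
    simp only [hmul]
    exact tendsto_setIntegral_mixedQuotient HX HY hw ha ha1 hb hb1)
  rw [← this, hmul]

end IsClampedX

/-! ### From the integral representation to pointwise derivatives. -/

theorem ae_fst_ne (c : ℝ) : ∀ᵐ p : ℝ × ℝ, p.1 ≠ c := by
  rw [Measure.volume_eq_prod]
  exact Measure.quasiMeasurePreserving_fst.ae (Measure.ae_ne volume c)

theorem ae_snd_ne (c : ℝ) : ∀ᵐ p : ℝ × ℝ, p.2 ≠ c := by
  rw [Measure.volume_eq_prod]
  exact Measure.quasiMeasurePreserving_snd.ae (Measure.ae_ne volume c)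

/-- For `p` off the two lines through the corner `q`, membership in the rectangle is unchanged when
`q` moves slightly. Dominated convergence with majorant |g| does the rest. -/
theorem continuous_setIntegral_rect {g : ℝ × ℝ → ℝ} (hg : Integrable g) :
    Continuous fun q : ℝ × ℝ => ∫ p in Ioc 0 q.1 ×ˢ Ioc 0 q.2, g p := by
  have hR : ∀ q : ℝ × ℝ, MeasurableSet (Ioc 0 q.1 ×ˢ Ioc 0 q.2) := fun q =>
    measurableSet_Ioc.prod measurableSet_Ioc
  simp only [← fun q => integral_indicator (f := g) (μ := volume) (hR q)]
  rw [continuous_iff_continuousAt]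
  intro q
  refine continuousAt_of_dominated (bound := fun p => ‖g p‖)
    (Eventually.of_forall fun q' => hg.aestronglyMeasurable.indicator (hR q'))
    (Eventually.of_forall fun q' => Eventually.of_forall fun p => norm_indicator_le_norm_self _ _)
    hg.norm ?_
  filter_upwards [ae_fst_ne q.1, ae_snd_ne q.2] with p h1 h2
  have e : ∀ a b : ℝ, a ≠ b → ∀ᶠ b' in 𝓝 b, (a ≤ b' ↔ a ≤ b) := by
    intro a b hab
    rcases lt_or_gt_of_ne hab with h | h
    · filter_upwards [eventually_gt_nhds h] with b' hb'
      exact ⟨fun _ => h.le, fun _ => hb'.le⟩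
    · filter_upwards [eventually_lt_nhds h] with b' hb'
      exact ⟨fun hc => absurd hc (not_le.2 hb'), fun hc => absurd hc (not_le.2 h)⟩
  have c1 := (continuous_fst.tendsto q).eventually (e _ _ h1)
  have c2 := (continuous_snd.tendsto q).eventually (e _ _ h2)
  refine ContinuousAt.congr (f := fun _ => (Ioc 0 q.1 ×ˢ Ioc 0 q.2).indicator g p)
    continuousAt_const ?_
  filter_upwards [c1, c2] with q' e1 e2
  simp only [indicator, mem_prod, mem_Ioc, e1, e2]

/-- By continuity, rational increments decide differentiability. This reduces it to countably many
conditions and makes the set of good points measurable, as Fubini's criterion for null sets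
requires. -/
theorem hasDerivAt_iff_rat {φ : ℝ → ℝ} (hφ : Continuous φ) (d x : ℝ) :
    HasDerivAt φ d x ↔ ∀ n : ℕ, ∃ m : ℕ, ∀ r : ℚ, |(r : ℝ)| < 1 / ((m : ℝ) + 1) →
      |φ (x + r) - φ x - r * d| ≤ 1 / ((n : ℝ) + 1) * |(r : ℝ)| := by
  rw [hasDerivAt_iff_isLittleO_nhds_zero, Asymptotics.isLittleO_iff]
  constructor
  · intro h n
    have h1 := h (c := 1 / ((n : ℝ) + 1)) (by positivity)
    obtain ⟨δ, hδ, h2⟩ := Metric.eventually_nhds_iff.1 h1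
    obtain ⟨m, hm⟩ := exists_nat_one_div_lt hδ
    refine ⟨m, fun r hr => ?_⟩
    have := h2 (y := (r : ℝ)) (by rw [Real.dist_eq, sub_zero]; exact hr.trans hm)
    simp only [Real.norm_eq_abs, smul_eq_mul] at this
    exact this
  · intro h c hc
    obtain ⟨n, hn⟩ := exists_nat_one_div_lt hc
    obtain ⟨m, hm⟩ := h n
    rw [Metric.eventually_nhds_iff]
    refine ⟨1 / ((m : ℝ) + 1), by positivity, fun t ht => ?_⟩
    rw [Real.dist_eq, sub_zero] at ht
    refine le_trans ?_ (mul_le_mul_of_nonneg_right hn.le (norm_nonneg t))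
    by_contra hcon
    rw [not_le] at hcon
    have ho : IsOpen ({s : ℝ | |s| < 1 / ((m : ℝ) + 1)} ∩
        {s : ℝ | 1 / ((n : ℝ) + 1) * |s| < |φ (x + s) - φ x - s * d|}) :=
      (isOpen_lt (by fun_prop) (by fun_prop)).inter (isOpen_lt (by fun_prop) (by fun_prop))
    obtain ⟨r, hr⟩ := Rat.denseRange_cast (𝕜 := ℝ) |>.exists_mem_open ho
      ⟨t, ht, by simpa using hcon⟩
    exact absurd (hm r hr.1) (not_le.2 hr.2)

theorem measurableSet_hasDerivAt_section {Φ d : ℝ × ℝ → ℝ} (hΦ : Measurable Φ) (hd : Measurable d)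
    (hc : ∀ x, Continuous fun y => Φ (x, y)) :
    MeasurableSet {p : ℝ × ℝ | HasDerivAt (fun y => Φ (p.1, y)) (d p) p.2} := by
  simp only [fun p : ℝ × ℝ => hasDerivAt_iff_rat (hc p.1) (d p) p.2, ofPred_forall, ofPred_exists]
  refine .iInter fun n => .iUnion fun m => .iInter fun r => .iInter fun hr =>
    measurableSet_le (by fun_prop) (by fun_prop)

theorem abs_deriv_le_of_abs_sub_le {ψ Φ : ℝ → ℝ} {x α β : ℝ} (hψ : HasDerivAt ψ α x)
    (hΦ : HasDerivAt Φ β x) (h : ∀ᶠ t in 𝓝[>] (0 : ℝ), |ψ (x + t) - ψ x| ≤ Φ (x + t) - Φ x) :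
    |α| ≤ β := by
  refine le_of_tendsto_of_tendsto hψ.tendsto_slope_zero_right.abs hΦ.tendsto_slope_zero_right ?_
  filter_upwards [h, self_mem_nhdsWithin] with t ht ht0
  have ht0 : 0 < t := ht0
  rw [smul_eq_mul, smul_eq_mul, abs_mul, abs_inv, abs_of_pos ht0]
  gcongr

/-- Lebesgue differentiation holds almost everywhere on each vertical line; measurability of the
good set turns this into a statement almost everywhere in the plane. -/
theorem ae_hasDerivAt_section {g : ℝ × ℝ → ℝ} (hgm : Measurable g)
    (hg : ∀ x, Integrable fun y => g (x, y)) :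
    ∀ᵐ p : ℝ × ℝ, HasDerivAt (fun y => ∫ t in (0 : ℝ)..y, g (p.1, t)) (g p) p.2 := by
  have hc : ∀ x, Continuous fun y => ∫ t in (0 : ℝ)..y, g (x, t) := fun x =>
    intervalIntegral.continuous_primitive (fun a b => (hg x).intervalIntegrable) 0
  have hm : Measurable fun p : ℝ × ℝ => ∫ t in (0 : ℝ)..p.2, g (p.1, t) := by
    have hm1 : ∀ y : ℝ, Measurable fun x => ∫ t in (0 : ℝ)..y, g (x, t) := fun y => by
      simp only [intervalIntegral]
      exact (hgm.stronglyMeasurable.integral_prod_right'.measurable).sub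
        (hgm.stronglyMeasurable.integral_prod_right'.measurable)
    exact (measurable_uncurry_of_continuous_of_measurable
      (u := fun y x => ∫ t in (0 : ℝ)..y, g (x, t)) hc hm1).comp measurable_swap
  have hS := measurableSet_hasDerivAt_section hm hgm hc
  rw [Measure.volume_eq_prod, Measure.ae_prod_iff_ae_ae hS]
  refine Eventually.of_forall fun x => ?_
  filter_upwards [LocallyIntegrable.ae_hasDerivAt_integral (hg x).locallyIntegrable] with y hy
  exact hy 0

theorem integrable_strip {g : ℝ × ℝ → ℝ} (hg : Integrable g) (c d : ℝ) :
    Integrable fun x => ∫ t in Ioc c d, g (x, t) := by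
  have h : Integrable g (volume.prod (volume.restrict (Ioc c d))) := by
    rw [← Measure.restrict_univ (μ := (volume : Measure ℝ)), Measure.restrict_restrict (by simp),
      Measure.prod_restrict, ← Measure.volume_eq_prod]
    exact hg.integrableOn
  exact h.integral_prod_left

/-- The partial derivative of a function with given mixed increments, on almost every line. -/
theorem ae_partial_eq {F p1 g : ℝ × ℝ → ℝ} (hg : Integrable g)
    (hgs : ∀ x, Integrable fun y => g (x, y))
    (hd : ∀ x ∈ Ioo (0 : ℝ) 1, ∀ y, HasDerivAt (fun s => F (s, y)) (p1 (x, y)) x)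
    (hrep : ∀ a ∈ Icc (0 : ℝ) 1, ∀ b ∈ Icc (0 : ℝ) 1, ∫ p in Ioc 0 a ×ˢ Ioc 0 b, g p =
      F (a, b) - F (a, 0) - (F (0, b) - F (0, 0))) :
    ∀ᵐ x, x ∈ Ioo (0 : ℝ) 1 → ∀ y ∈ Icc (0 : ℝ) 1,
      p1 (x, y) = p1 (x, 0) + ∫ t in (0 : ℝ)..y, g (x, t) := by
  set G : ℝ → ℝ → ℝ := fun y x => ∫ t in Ioc 0 y, g (x, t) with hG
  have hGi : ∀ y, Integrable (G y) := fun y => integrable_strip hg 0 y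
  have hprim : ∀ y ∈ Icc (0 : ℝ) 1, ∀ a ∈ Icc (0 : ℝ) 1, ∫ s in (0 : ℝ)..a, G y s =
      F (a, y) - F (a, 0) - (F (0, y) - F (0, 0)) := by
    intro y hy a ha
    rw [← hrep a ha y hy, Measure.volume_eq_prod, setIntegral_prod,
      intervalIntegral.integral_of_le ha.1]
    rw [← Measure.volume_eq_prod]
    exact hg.integrableOn
  -- Lebesgue differentiation in `x` has an exceptional null set depending on `y`. Restricting to
  -- rational heights, here and for the majorants `A c d`, leaves a single null set.
  have hae1 : ∀ᵐ x, ∀ q : ℚ, HasDerivAt (fun a => ∫ s in (0 : ℝ)..a, G q s) (G q x) x := by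
    rw [ae_all_iff]
    intro q
    filter_upwards [LocallyIntegrable.ae_hasDerivAt_integral (hGi q).locallyIntegrable] with x hx
    exact hx 0
  set A : ℝ → ℝ → ℝ → ℝ := fun c d x => ∫ t in Ioc c d, |g (x, t)| with hA
  have hAi : ∀ c d, Integrable (A c d) := fun c d => integrable_strip hg.abs c d
  have hae2 : ∀ᵐ x, ∀ c d : ℚ, HasDerivAt (fun a => ∫ s in (0 : ℝ)..a, A c d s) (A c d x) x := by
    simp only [ae_all_iff]
    intro c d
    filter_upwards [LocallyIntegrable.ae_hasDerivAt_integral (hAi c d).locallyIntegrable] with x hx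
    exact hx 0
  have hGdiff : ∀ x c y d : ℝ, 0 ≤ c → c ≤ y → y ≤ d → |G y x - G c x| ≤ A c d x := by
    intro x c y d hc hcy hyd
    have e : G y x - G c x = ∫ t in Ioc c y, g (x, t) := by
      simp only [hG]
      rw [← intervalIntegral.integral_of_le (hc.trans hcy), ← intervalIntegral.integral_of_le hc,
        ← intervalIntegral.integral_of_le hcy]
      exact intervalIntegral.integral_interval_sub_left (hgs x).intervalIntegrable
        (hgs x).intervalIntegrable
    rw [e]
    refine (abs_integral_le_integral_abs).trans ?_
    exact setIntegral_mono_set (hgs x).abs.integrableOn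
      (Eventually.of_forall fun t => abs_nonneg _) (Ioc_subset_Ioc_right hyd).eventuallyLE
  filter_upwards [hae1, hae2] with x h1 h2 hx y hy
  have hder : ∀ y ∈ Icc (0 : ℝ) 1,
      HasDerivAt (fun a => ∫ s in (0 : ℝ)..a, G y s) (p1 (x, y) - p1 (x, 0)) x := by
    intro y hy
    have h3 : HasDerivAt (fun a => F (a, y) - F (a, 0) - (F (0, y) - F (0, 0)))
        (p1 (x, y) - p1 (x, 0)) x := ((hd x hx y).sub (hd x hx 0)).sub_const _
    refine h3.congr_of_eventuallyEq ?_
    filter_upwards [Ioo_mem_nhds hx.1 hx.2] with a ha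
    exact hprim y hy a ⟨ha.1.le, ha.2.le⟩
  have hgoal : p1 (x, y) - p1 (x, 0) = G y x := by
    rcases hy.1.eq_or_lt with rfl | hy0
    · simp [hG]
    -- To reach every `y`, it is enclosed between rationals c < y < d with ∫_c^d |g(x,t)| dt ≤ ε/2.
    -- At height c both sides agree, and from c to y each changes by at most this integral. For
    -- `p1`, whose continuity in `y` is not yet known, this follows by differentiating the
    -- domination of increments at `x`.
    refine eq_of_abs_sub_le_all fun ε hε => ?_
    have hcont : Continuous fun u => ∫ t in (0 : ℝ)..u, |g (x, t)| :=
      intervalIntegral.continuous_primitive (fun a b => (hgs x).abs.intervalIntegrable) 0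
    obtain ⟨δ, hδ, hδ'⟩ := Metric.continuous_iff.1 hcont y (ε / 4) (by positivity)
    obtain ⟨c, hc1, hc2⟩ := exists_rat_btwn (max_lt hy0 (sub_lt_self y hδ))
    obtain ⟨d, hd1, hd2⟩ := exists_rat_btwn (lt_add_of_pos_right y hδ)
    have hc0 : (0 : ℝ) < c := (le_max_left _ _).trans_lt hc1
    have hcδ : y - δ < c := (le_max_right _ _).trans_lt hc1
    have hcm : (c : ℝ) ∈ Icc (0 : ℝ) 1 := ⟨hc0.le, hc2.le.trans hy.2⟩
    have hsmall : A c d x ≤ ε / 2 := by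
      have b1 := hδ' c (by rw [Real.dist_eq, abs_lt]; constructor <;> linarith)
      have b2 := hδ' d (by rw [Real.dist_eq, abs_lt]; constructor <;> linarith)
      rw [Real.dist_eq, abs_lt] at b1 b2
      have e : A c d x = (∫ t in (0 : ℝ)..d, |g (x, t)|) - ∫ t in (0 : ℝ)..c, |g (x, t)| := by
        simp only [hA]
        rw [← intervalIntegral.integral_of_le (hc2.le.trans hd1.le)]
        exact (intervalIntegral.integral_interval_sub_left (hgs x).abs.intervalIntegrable
          (hgs x).abs.intervalIntegrable).symm
      rw [e]
      linarith [b1.1, b2.2]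
    have t1 : |G y x - G c x| ≤ A c d x := hGdiff x c y d hc0.le hc2.le hd1.le
    have t2 : p1 (x, c) - p1 (x, 0) = G c x := (hder c hcm).unique (h1 c)
    have t3 : |(p1 (x, y) - p1 (x, 0)) - (p1 (x, c) - p1 (x, 0))| ≤ A c d x := by
      refine abs_deriv_le_of_abs_sub_le ((hder y hy).sub (hder c hcm)) (h2 c d) ?_
      filter_upwards [self_mem_nhdsWithin] with t ht
      have ht : 0 < t := ht
      have iI : ∀ {u : ℝ → ℝ} (_ : Integrable u) (a b : ℝ), IntervalIntegrable u volume a b :=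
        fun hu a b => hu.intervalIntegrable
      have iD : Integrable fun s => G y s - G c s := (hGi y).sub (hGi c)
      simp only [Pi.sub_apply]
      rw [intervalIntegral.integral_interval_sub_left (iI (hAi c d) _ _) (iI (hAi c d) _ _),
        ← intervalIntegral.integral_sub (iI (hGi y) _ _) (iI (hGi c) _ _),
        ← intervalIntegral.integral_sub (iI (hGi y) _ _) (iI (hGi c) _ _),
        intervalIntegral.integral_interval_sub_left (iI iD _ _)
          (iI iD _ _)]
      rw [← Real.norm_eq_abs]
      exact intervalIntegral.norm_integral_le_of_norm_le (by linarith)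
        (Eventually.of_forall fun s _ => (Real.norm_eq_abs _).trans_le <|
          hGdiff s c y d hc0.le hc2.le hd1.le) (iI (hAi c d) _ _)
    rw [t2] at t3
    calc |p1 (x, y) - p1 (x, 0) - G y x|
        = |(p1 (x, y) - p1 (x, 0) - G c x) - (G y x - G c x)| := by congr 1; ring
      _ ≤ ε := (abs_sub _ _).trans (by linarith)
  rw [intervalIntegral.integral_of_le hy.1]
  linarith [hgoal]

/-- Almost all sections of `g` are integrable by Fubini. Setting `g` to zero on the remaining null
set of lines makes all of them so, without altering integrals over rectangles. -/
theorem exists_integrable_sections {g : ℝ × ℝ → ℝ} (hgm : Measurable g) (hg : Integrable g) :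
    ∃ g' : ℝ × ℝ → ℝ, Measurable g' ∧ Integrable g' ∧ g' =ᵐ[volume] g ∧
      ∀ x, Integrable fun y => g' (x, y) := by
  set S : Set ℝ := {x | Integrable fun y => g (x, y)} with hS
  have hSm : MeasurableSet S := measurableSet_integrable (f := fun x y => g (x, y))
    hgm.stronglyMeasurable
  have hSae : ∀ᵐ x, x ∈ S := by
    rw [Measure.volume_eq_prod] at hg
    exact hg.prod_right_ae
  have hm : MeasurableSet (Prod.fst ⁻¹' S : Set (ℝ × ℝ)) := measurable_fst hSm
  refine ⟨(Prod.fst ⁻¹' S).indicator g, hgm.indicator hm, hg.indicator hm, ?_, fun x => ?_⟩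
  · have : ∀ᵐ p : ℝ × ℝ, p.1 ∈ S := by
      rw [Measure.volume_eq_prod]
      exact Measure.quasiMeasurePreserving_fst.ae hSae
    filter_upwards [this] with p hp
    exact indicator_of_mem (s := Prod.fst ⁻¹' S) hp g
  · by_cases hx : x ∈ S
    · refine Integrable.congr hx (Eventually.of_forall fun y => ?_)
      exact (indicator_of_mem (s := Prod.fst ⁻¹' S) (a := (x, y)) hx g).symm
    · refine (integrable_zero ℝ ℝ volume).congr (Eventually.of_forall fun y => ?_)
      exact (indicator_of_notMem (s := Prod.fst ⁻¹' S) (a := (x, y)) hx g).symm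

/-- If the mixed increments of `F` are integrals of `g`, then the partial derivative of `F` in the
first variable has, on almost every line, the derivative `g` in the second variable. -/
theorem ae_continuousOn_and_hasDerivAt {F p1 g : ℝ × ℝ → ℝ} (hgm : Measurable g)
    (hg : Integrable g)
    (hd : ∀ x ∈ Ioo (0 : ℝ) 1, ∀ y, HasDerivAt (fun s => F (s, y)) (p1 (x, y)) x)
    (hrep : ∀ a ∈ Icc (0 : ℝ) 1, ∀ b ∈ Icc (0 : ℝ) 1, ∫ p in Ioc 0 a ×ˢ Ioc 0 b, g p =
      F (a, b) - F (a, 0) - (F (0, b) - F (0, 0))) :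
    (∀ᵐ x, x ∈ Ioo (0 : ℝ) 1 → ContinuousOn (fun y => p1 (x, y)) (Icc 0 1)) ∧
    ∀ᵐ p : ℝ × ℝ, p ∈ Ioo (0 : ℝ) 1 ×ˢ Ioo (0 : ℝ) 1 →
      HasDerivAt (fun y => p1 (p.1, y)) (g p) p.2 := by
  obtain ⟨g', hgm', hg', hae, hgs⟩ := exists_integrable_sections hgm hg
  have hpart := ae_partial_eq (F := F) (p1 := p1) hg' hgs hd (fun a ha b hb => by
    rw [← hrep a ha b hb]
    exact integral_congr_ae (ae_restrict_of_ae hae))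
  constructor
  · filter_upwards [hpart] with x h hx
    have hc : Continuous fun y => p1 (x, 0) + ∫ t in (0 : ℝ)..y, g' (x, t) :=
      continuous_const.add
        (intervalIntegral.continuous_primitive (fun a b => (hgs x).intervalIntegrable) 0)
    exact hc.continuousOn.congr (h hx)
  · have h1 : ∀ᵐ p : ℝ × ℝ, p.1 ∈ Ioo (0 : ℝ) 1 → ∀ y ∈ Icc (0 : ℝ) 1,
        p1 (p.1, y) = p1 (p.1, 0) + ∫ t in (0 : ℝ)..y, g' (p.1, t) := by
      rw [Measure.volume_eq_prod]
      exact Measure.quasiMeasurePreserving_fst.ae hpart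
    filter_upwards [h1, hae, ae_hasDerivAt_section hgm' hgs] with p e1 e2 e3 hp
    rw [← e2]
    refine (e3.const_add (p1 (p.1, 0))).congr_of_eventuallyEq ?_
    filter_upwards [Ioo_mem_nhds hp.2.1 hp.2.2] with y hy
    exact e1 hp.1 y ⟨hy.1.le, hy.2.le⟩

/-- The sides a = 1 and b = 1 left no room for the increments. They are reached by continuity of
both sides, first in `a` and then in `b`, so separate continuity of `F` is enough. -/
theorem IsClampedX.exists_weak_mixed_derivative {F p1 p2 q1 q2 : ℝ × ℝ → ℝ}
    (HX : IsClampedX F p1 p2) (HY : IsClampedX (fun p => F p.swap) q1 q2) :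
    ∃ g : ℝ × ℝ → ℝ, Measurable g ∧ Integrable g ∧ MemLp g 2 ∧
      ∀ a ∈ Icc (0 : ℝ) 1, ∀ b ∈ Icc (0 : ℝ) 1, ∫ p in Ioc 0 a ×ˢ Ioc 0 b, g p =
        F (a, b) - F (a, 0) - (F (0, b) - F (0, 0)) := by
  obtain ⟨g0, hg0, hrep⟩ := HX.exists_weak_mixed_derivative_of_lt HY
  obtain ⟨gm, hgm, hae⟩ := hg0.aestronglyMeasurable
  have hR : ∀ a b : ℝ, MeasurableSet (Ioc 0 a ×ˢ Ioc 0 b) := fun a b =>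
    measurableSet_Ioc.prod measurableSet_Ioc
  set g : ℝ × ℝ → ℝ := (Ioc 0 1 ×ˢ Ioc 0 1).indicator gm with hgdef
  have hg2 : MemLp g 2 := ((memLp_congr_ae hae).1 hg0).indicator (hR 1 1)
  have hgi : Integrable g := by
    rw [hgdef, integrable_indicator_iff (hR 1 1)]
    have : IsFiniteMeasure (volume.restrict (Ioc 0 1 ×ˢ Ioc 0 1) : Measure (ℝ × ℝ)) := by
      refine ⟨?_⟩
      rw [Measure.restrict_apply_univ, Measure.volume_eq_prod, Measure.prod_prod]
      exact ENNReal.mul_lt_top (by simp) (by simp)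
    exact (((memLp_congr_ae hae).1 hg0).restrict _).integrable one_le_two
  have hlt : ∀ a ∈ Ico (0 : ℝ) 1, ∀ b ∈ Ico (0 : ℝ) 1, ∫ p in Ioc 0 a ×ˢ Ioc 0 b, g p =
        F (a, b) - F (a, 0) - (F (0, b) - F (0, 0)) := by
    intro a ha b hb
    rw [← hrep a b ha.1 ha.2 hb.1 hb.2, integral_congr_ae (ae_restrict_of_ae hae)]
    refine setIntegral_congr_fun (hR a b) fun p hp => ?_
    exact indicator_of_mem (show p ∈ Ioc (0 : ℝ) 1 ×ˢ Ioc (0 : ℝ) 1 from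
      ⟨⟨hp.1.1, hp.1.2.trans ha.2.le⟩, ⟨hp.2.1, hp.2.2.trans hb.2.le⟩⟩) gm
  refine ⟨g, hgm.measurable.indicator (hR 1 1), hgi, hg2, ?_⟩
  have hJ := continuous_setIntegral_rect hgi
  have hcl : closure (Ico (0 : ℝ) 1) = Icc 0 1 := closure_Ico zero_ne_one
  have hstep : ∀ b ∈ Ico (0 : ℝ) 1, ∀ a ∈ Icc (0 : ℝ) 1, ∫ p in Ioc 0 a ×ˢ Ioc 0 b, g p =
        F (a, b) - F (a, 0) - (F (0, b) - F (0, 0)) := by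
    intro b hb
    rw [← hcl]
    refine EqOn.closure (f := fun a => ∫ p in Ioc 0 a ×ˢ Ioc 0 b, g p)
      (g := fun a => F (a, b) - F (a, 0) - (F (0, b) - F (0, 0))) (fun a ha => hlt a ha b hb)
      (hJ.comp (by fun_prop : Continuous fun a : ℝ => (a, b)))
      (((HX.c2 b).cont.sub (HX.c2 0).cont).sub continuous_const)
  intro a ha
  rw [← hcl]
  exact EqOn.closure (f := fun b => ∫ p in Ioc 0 a ×ˢ Ioc 0 b, g p)
      (g := fun b => F (a, b) - F (a, 0) - (F (0, b) - F (0, 0))) (fun b hb => hstep b hb a ha)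
      (hJ.comp (by fun_prop : Continuous fun b : ℝ => (a, b)))
      (((HY.c2 a).cont.sub continuous_const).sub ((HY.c2 0).cont.sub continuous_const))

/-! ### Clamping to the square and the main theorem. -/

/-- The projection of the line onto the unit interval. -/
noncomputable def clamp (t : ℝ) : ℝ := max 0 (min 1 t)

theorem continuous_clamp : Continuous clamp := by unfold clamp; fun_prop

theorem clamp_mem (t : ℝ) : clamp t ∈ Icc (0 : ℝ) 1 :=
  ⟨le_max_left _ _, max_le zero_le_one (min_le_left _ _)⟩

theorem clamp_of_mem {t : ℝ} (ht : t ∈ Icc (0 : ℝ) 1) : clamp t = t := by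
  rw [clamp, min_eq_right ht.2, max_eq_right ht.1]

theorem clamp_of_le {t : ℝ} (ht : t ≤ 0) : clamp t = clamp 0 := by
  rw [clamp_of_mem (by simp : (0 : ℝ) ∈ Icc (0 : ℝ) 1), clamp, max_eq_left ((min_le_right _ _).trans ht)]

theorem clamp_of_ge {t : ℝ} (ht : 1 ≤ t) : clamp t = clamp 1 := by
  rw [clamp, clamp, min_eq_left ht, min_self]

theorem hasDerivAt_comp_clamp {u : ℝ → ℝ} {x : ℝ} (hx : x ∈ Ioo (0 : ℝ) 1)
    (hu : DifferentiableWithinAt ℝ u (Icc 0 1) x) :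
    HasDerivAt (fun t => u (clamp t)) (derivWithin u (Icc 0 1) x) x := by
  refine (hu.hasDerivWithinAt.hasDerivAt (Icc_mem_nhds hx.1 hx.2)).congr_of_eventuallyEq ?_
  filter_upwards [Icc_mem_nhds hx.1 hx.2] with t ht
  rw [clamp_of_mem ht]

theorem continuous_comp_clamp {u : ℝ → ℝ}
    (hu : ∀ x ∈ Icc (0 : ℝ) 1, DifferentiableWithinAt ℝ u (Icc 0 1) x) :
    Continuous fun t => u (clamp t) :=
  ContinuousOn.comp_continuous (fun x hx => (hu x hx).continuousWithinAt) continuous_clamp clamp_mem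

theorem restrict_unitSquare : (volume : Measure (ℝ × ℝ)).restrict unitSquare =
    (volume.restrict (Icc (0 : ℝ) 1)).prod (volume.restrict (Icc (0 : ℝ) 1)) := by
  rw [Measure.prod_restrict, ← Measure.volume_eq_prod, unitSquare]

/-- The second derivative is written with `deriv` of the clamped function because every section is
then Borel measurable; square integrability alone gives only almost everywhere measurability in the
plane. -/
theorem isClampedX_clamp {f : ℝ × ℝ → ℝ} (hx : ∀ p ∈ unitSquare, DiffX f p)
    (hxx : ∀ p ∈ unitSquare, DiffX (partialX f) p)
    (hsq : SquareIntegrable (partialX (partialX f))) :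
    IsClampedX (fun p => f (clamp p.1, clamp p.2)) (fun p => partialX f (clamp p.1, clamp p.2))
      (fun p => (Ioo 0 1).indicator
        (deriv fun t => partialX f (clamp t, clamp p.2)) p.1) := by
  have hder : ∀ y, ∀ x ∈ Ioo (0 : ℝ) 1, HasDerivAt (fun t => partialX f (clamp t, clamp y))
      (partialX (partialX f) (x, clamp y)) x := fun y x hxm =>
    hasDerivAt_comp_clamp (u := fun t => partialX f (t, clamp y)) hxm
      (hxx (x, clamp y) ⟨⟨hxm.1.le, hxm.2.le⟩, clamp_mem y⟩)
  have hS : ∀ y ∈ Icc (0 : ℝ) 1, ∫⁻ x, ‖(Ioo (0 : ℝ) 1).indicator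
      (deriv fun t => partialX f (clamp t, clamp y)) x‖ₑ ^ 2 =
      ∫⁻ x in Icc 0 1, ‖partialX (partialX f) (x, y)‖ₑ ^ 2 := by
    intro y hy
    rw [← restrict_Ioo_eq_restrict_Icc, ← lintegral_indicator measurableSet_Ioo]
    refine lintegral_congr fun x => ?_
    by_cases hxm : x ∈ Ioo (0 : ℝ) 1
    · rw [indicator_of_mem hxm, indicator_of_mem hxm, (hder y x hxm).deriv, clamp_of_mem hy]
    · rw [indicator_of_notMem hxm, indicator_of_notMem hxm]
      simp
  have hm := hsq.aestronglyMeasurable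
  have hfin := (memLp_two_iff_lintegral hm).1 hsq
  rw [restrict_unitSquare] at hm hfin
  have hm2 := hm.enorm.pow_const 2
  refine ⟨fun y => ?_, ?_, ?_⟩
  · exact
    { cont := continuous_comp_clamp (u := fun t => f (t, clamp y))
        fun x hxm => hx (x, clamp y) ⟨hxm, clamp_mem y⟩
      left := fun x hx0 => by simp only [clamp_of_le hx0]
      right := fun x hx1 => by simp only [clamp_of_ge hx1]
      hasDeriv := fun x hxm => by
        have := hasDerivAt_comp_clamp (u := fun t => f (t, clamp y)) hxm
          (hx (x, clamp y) ⟨⟨hxm.1.le, hxm.2.le⟩, clamp_mem y⟩)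
        simp only [clamp_of_mem (⟨hxm.1.le, hxm.2.le⟩ : x ∈ Icc (0 : ℝ) 1)]
        exact this
      cont1 := continuous_comp_clamp (u := fun t => partialX f (t, clamp y))
        fun x hxm => hxx (x, clamp y) ⟨hxm, clamp_mem y⟩
      left1 := fun x hx0 => by simp only [clamp_of_le hx0]
      right1 := fun x hx1 => by simp only [clamp_of_ge hx1]
      hasDeriv1 := fun x hxm => by
        rw [indicator_of_mem hxm]
        exact (hder y x hxm).differentiableAt.hasDerivAt
      meas2 := (measurable_deriv fun t => partialX f (clamp t, clamp y)).indicator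
        measurableSet_Ioo
      zero2 := fun x hxm => indicator_of_notMem hxm _ }
  · refine hm2.lintegral_prod_left'.congr ?_
    filter_upwards [ae_restrict_mem measurableSet_Icc] with y hy
    exact (hS y hy).symm
  · rw [setLIntegral_congr_fun measurableSet_Icc hS, ← lintegral_prod_symm _ hm2]
    exact hfin

/-- Transfer from the open square and the clamped derivative to the one-sided notions. -/
theorem hasDerivWithinAt_of_clamp {u : ℝ → ℝ → ℝ} {d : ℝ} {x y : ℝ}
    (hx : x ∈ Ioo (0 : ℝ) 1) (hy : y ∈ Ioo (0 : ℝ) 1)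
    (h : HasDerivAt (fun t => u (clamp x) (clamp t)) d y) :
    DifferentiableWithinAt ℝ (u x) (Icc 0 1) y ∧ derivWithin (u x) (Icc 0 1) y = d := by
  rw [clamp_of_mem ⟨hx.1.le, hx.2.le⟩] at h
  have h1 : HasDerivAt (u x) d y := by
    refine h.congr_of_eventuallyEq ?_
    filter_upwards [Icc_mem_nhds hy.1 hy.2] with t ht
    rw [clamp_of_mem ht]
  exact ⟨h1.hasDerivWithinAt.differentiableWithinAt,
    h1.hasDerivWithinAt.derivWithin (uniqueDiffOn_Icc zero_lt_one y ⟨hy.1.le, hy.2.le⟩)⟩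

theorem theorem4p1 (f : ℝ × ℝ → ℝ)
    (hx : ∀ p ∈ unitSquare, DiffX f p)
    (hxx : ∀ p ∈ unitSquare, DiffX (partialX f) p)
    (hy : ∀ p ∈ unitSquare, DiffY f p)
    (hyy : ∀ p ∈ unitSquare, DiffY (partialY f) p)
    (hxx_sq : SquareIntegrable (partialX (partialX f)))
    (hyy_sq : SquareIntegrable (partialY (partialY f))) :
    ((∀ᵐ p ∂(volume.restrict unitSquare),
        DiffY (partialX f) p ∧ DiffX (partialY f) p ∧
          partialY (partialX f) p = partialX (partialY f) p) ∧
      SquareIntegrable (partialY (partialX f)) ∧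
      SquareIntegrable (partialX (partialY f))) ∧
    (∃ A : Set ℝ, A ⊆ Icc 0 1 ∧ MeasurableSet A ∧ volume A = 1 ∧
      ∀ x ∈ A, ∀ y ∈ Icc (0 : ℝ) 1,
        ContinuousWithinAt (fun t => partialX f (x, t)) (Icc 0 1) y) ∧
    ContinuousOn f unitSquare := by
  have hswap : ∀ p ∈ unitSquare, p.swap ∈ unitSquare := fun p hp => ⟨hp.2, hp.1⟩
  have hmp : MeasurePreserving Prod.swap (volume : Measure (ℝ × ℝ)) volume := by
    rw [Measure.volume_eq_prod]
    exact Measure.measurePreserving_swap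
  have HX := isClampedX_clamp hx hxx hxx_sq
  have hsqY : SquareIntegrable (partialX (partialX fun p => f p.swap)) := by
    have h1 : MeasurePreserving Prod.swap ((volume : Measure (ℝ × ℝ)).restrict unitSquare)
        (volume.restrict unitSquare) := by
      rw [restrict_unitSquare]
      exact Measure.measurePreserving_swap
    exact MemLp.comp_measurePreserving hyy_sq h1
  have HY := isClampedX_clamp (f := fun p => f p.swap) (fun p hp => hy p.swap (hswap p hp))
    (fun p hp => hyy p.swap (hswap p hp)) hsqY
  set F : ℝ × ℝ → ℝ := fun p => f (clamp p.1, clamp p.2) with hF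
  have HY' : IsClampedX (fun p => F p.swap) _ _ := HY
  obtain ⟨g, hgm, hgi, hg2, hrep⟩ := HX.exists_weak_mixed_derivative HY'
  obtain ⟨hcontX, hderX⟩ := ae_continuousOn_and_hasDerivAt (F := F)
    (p1 := fun p => partialX f (clamp p.1, clamp p.2)) hgm hgi
    (fun x hxm y => (HX.c2 y).hasDeriv x hxm) hrep
  -- The transposed function is represented by the transposed `g`. Both mixed derivatives are
  -- therefore identified with the same function, which is why they agree.
  obtain ⟨-, hderY⟩ := ae_continuousOn_and_hasDerivAt (F := fun p => F p.swap)
    (p1 := fun p => partialX (fun q => f q.swap) (clamp p.1, clamp p.2))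
    (g := fun p => g p.swap) (hgm.comp measurable_swap) (hmp.integrable_comp_of_integrable hgi)
    (fun x hxm y => (HY.c2 y).hasDeriv x hxm) (fun a ha b hb => by
      have h1 := setIntegral_prod_swap (μ := (volume : Measure ℝ)) (ν := (volume : Measure ℝ))
        (Ioc 0 b) (Ioc 0 a) g
      rw [Measure.volume_eq_prod, h1, ← Measure.volume_eq_prod, hrep b hb a ha]
      simp only [Prod.swap_prod_mk]
      ring)
  have hderY' := hmp.quasiMeasurePreserving.ae hderY
  have hopen : ∀ᵐ p ∂(volume.restrict unitSquare), p ∈ Ioo (0 : ℝ) 1 ×ˢ Ioo (0 : ℝ) 1 := by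
    rw [unitSquare, ae_restrict_iff' (measurableSet_Icc.prod measurableSet_Icc)]
    filter_upwards [ae_fst_ne 0, ae_fst_ne 1, ae_snd_ne 0, ae_snd_ne 1] with p a1 a2 a3 a4 hp
    exact ⟨⟨lt_of_le_of_ne hp.1.1 a1.symm, lt_of_le_of_ne hp.1.2 a2⟩,
      ⟨lt_of_le_of_ne hp.2.1 a3.symm, lt_of_le_of_ne hp.2.2 a4⟩⟩
  have hX : ∀ᵐ p ∂(volume.restrict unitSquare),
      DiffY (partialX f) p ∧ partialY (partialX f) p = g p := by
    filter_upwards [hopen, ae_restrict_of_ae hderX] with p hp h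
    exact hasDerivWithinAt_of_clamp (u := fun x y => partialX f (x, y)) hp.1 hp.2 (h hp)
  have hY : ∀ᵐ p ∂(volume.restrict unitSquare),
      DiffX (partialY f) p ∧ partialX (partialY f) p = g p := by
    filter_upwards [hopen, ae_restrict_of_ae hderY'] with p hp h
    exact hasDerivWithinAt_of_clamp (u := fun y x => partialY f (x, y)) hp.2 hp.1
      (h ⟨hp.2, hp.1⟩)
  refine ⟨⟨?_, ?_, ?_⟩, ?_, ?_⟩
  · filter_upwards [hX, hY] with p h1 h2
    exact ⟨h1.1, h2.1, h1.2.trans h2.2.symm⟩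
  · exact (memLp_congr_ae (hX.mono fun p h => h.2)).2 (hg2.restrict _)
  · exact (memLp_congr_ae (hY.mono fun p h => h.2)).2 (hg2.restrict _)
  -- The exceptional set is null but perhaps not measurable, so its measurable hull is removed.
  · set T : Set ℝ := {x | ¬(x ∈ Ioo (0 : ℝ) 1 →
      ContinuousOn (fun y => partialX f (clamp x, clamp y)) (Icc 0 1))} with hT
    have hT0 : volume T = 0 := hcontX
    refine ⟨Ioo 0 1 \ toMeasurable volume T, fun x hxm => ⟨hxm.1.1.le, hxm.1.2.le⟩,
      measurableSet_Ioo.diff (measurableSet_toMeasurable _ _), ?_, fun x hxm y hym => ?_⟩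
    · rw [measure_sdiff_null ((measure_toMeasurable T).trans hT0)]
      simp
    · have h1 : ContinuousOn (fun y => partialX f (clamp x, clamp y)) (Icc 0 1) := by
        by_contra hcon
        exact hxm.2 (subset_toMeasurable _ _ fun h => hcon (h hxm.1))
      rw [clamp_of_mem ⟨hxm.1.1.le, hxm.1.2.le⟩] at h1
      exact (h1.congr fun t ht => by rw [clamp_of_mem ht]) y hym
  -- Joint continuity is read off from the representation: the rectangle integral is jointly
  -- continuous and the boundary terms depend on one variable each.
  · have hJ := continuous_setIntegral_rect hgi
    have c1 : Continuous fun p : ℝ × ℝ => F (p.1, 0) := (HX.c2 0).cont.comp continuous_fst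
    have c2 : Continuous fun p : ℝ × ℝ => F (0, p.2) := (HY.c2 0).cont.comp continuous_snd
    have hc : Continuous fun p : ℝ × ℝ => (∫ q in Ioc 0 p.1 ×ˢ Ioc 0 p.2, g q) + F (p.1, 0) +
        (F (0, p.2) - F (0, 0)) := (hJ.add c1).add (c2.sub continuous_const)
    refine hc.continuousOn.congr fun p hp => ?_
    have h1 := hrep p.1 hp.1 p.2 hp.2
    have h2 : F (p.1, p.2) = f p := by simp only [hF, clamp_of_mem hp.1, clamp_of_mem hp.2]
    rw [← h2]
    linarith
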